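/- Let $k$ be an algebraically closed field of characteristic $0$, let $X$ be a smooth projective three-fold over $k$ (integral, of dimension $3$), and let $R$ be a discrete valuation ring that is a $k$-algebra, with uniformiser $\pi$. Put $X_R = X\otimes_k R$ and $X_m = X\otimes_k R/\pi^m$ for $m\ge 1$, and let $\iota_m : X_m \to X_R$ and, for $1\le m'<m$, $\iota_{m,m'} : X_{m'}\to X_m$ be the closed immersions induced by $R\to R/\pi^m$ and $R/\pi^m\to R/\pi^{m'}$. For a Noetherian scheme $Y$, let $D(Y)$ be the unbounded derived category of the category $\mathrm{Coh}(Y)$ of coherent sheaves on $Y$. Let $\mathrm{Coh}_{\le 1}(Y)$ consist of the coherent sheaves whose support has dimension at most $1$, and let $\mathrm{Coh}_{\ge 2}(Y)$ consist of the coherent sheaves $E$ with $\mathrm{Hom}(F,E)=0$ for all $F\in \mathrm{Coh}_{\le 1}(Y)$. Let $\mathcal A^p_m\subset D(X_m)$ be the full subcategory of those $E$ with $H^0(E)\in \mathrm{Coh}_{\le 1}(X_m)$, $H^{-1}(E)\in \mathrm{Coh}_{\ge 2}(X_m)$ and $H^i(E)=0$ for all $i\ne 0,-1$. The exact functors of pushforward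 of coherent sheaves along $\iota_m$ and $\iota_{m,m'}$ induce functors $\iota_{m*}:D(X_m)\to D(X_R)$ and $\iota_{m,m'*}:D(X_{m'})\to D(X_m)$. (a) For every $m\ge 1$ and all $A,B\in\mathcal A^p_m$, the map $$\mathrm{Hom}_{\mathcal A^p_m}(A,B)\to \mathrm{Hom}_{D(X_R)}(\iota_{m*}A,\iota_{m*}B),\qquad f\mapsto \iota_{m*}f,$$ is bijective. (b) For all $1\le m'<m$, the functor $\iota_{m,m'*}$ takes $\mathcal A^p_{m'}$ into $\mathcal A^p_m$, and for all $A,B\in\mathcal A^p_{m'}$ the map $$\mathrm{Hom}_{\mathcal A^p_{m'}}(A,B)\to \mathrm{Hom}_{\mathcal A^p_m}(\iota_{m,m'*}A,\iota_{m,m'*}B),\qquad f\mapsto \iota_{m,m'*}f,$$ is bijective. -/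

import Mathlib

open CategoryTheory Limits AlgebraicGeometry TopologicalSpace Opposite
universe u
namespace PTCoh

/-- `M(V) → M(W)` behaves like inverting `g`. -/
def LocAt {X : Scheme.{u}} (M : X.Modules) {U V W : X.Opens} (g : Γ(X, U)) (hV : V ≤ U)
    (hW : W ≤ V) : Prop :=
  (∀ s : Γ(M, W), ∃ (n : ℕ) (t : Γ(M, V)),
      M.presheaf.map (homOfLE hW).op t = (X.presheaf.map (homOfLE (hW.trans hV)).op g) ^ n • s) ∧
  (∀ t : Γ(M, V), M.presheaf.map (homOfLE hW).op t = 0 →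
      ∃ n : ℕ, (X.presheaf.map (homOfLE hV).op g) ^ n • t = 0)

theorem image_fromSpec_le {X : Scheme.{u}} {U : X.Opens} (hU : IsAffineOpen U)
    (V : (Spec Γ(X, U)).Opens) : hU.fromSpec ''ᵁ V ≤ U := by
  refine (Scheme.Hom.image_mono _ le_top).trans (le_of_eq ?_)
  simp

theorem smul_restrict_fromSpec {X : Scheme.{u}} (M : X.Modules) {U : X.Opens}
    (hU : IsAffineOpen U) (V : (Spec Γ(X, U)).Opens) (g : Γ(X, U))
    (x : Γ(M.restrict hU.fromSpec, V)) :
    (M.restrictAppIso hU.fromSpec V).hom (g • x) =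
      (X.presheaf.map (homOfLE (image_fromSpec_le hU V)).op g) •
        (M.restrictAppIso hU.fromSpec V).hom x := by
  rw [Scheme.Modules.smul_Spec_def, Scheme.Modules.smul_restrictAppIso_hom_apply]
  congr 1
  have h : (Scheme.ΓSpecIso Γ(X, U)).inv ≫ (Spec Γ(X, U)).presheaf.map V.leTop.op ≫
      (hU.fromSpec.appIso V).inv = X.presheaf.map (homOfLE (image_fromSpec_le hU V)).op := by
    rw [← cancel_mono (hU.fromSpec.appIso V).hom]
    rw [Category.assoc, Category.assoc, Iso.inv_hom_id, Category.comp_id, Scheme.Hom.appIso_hom',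
      Scheme.Hom.map_appLE, Scheme.Hom.appLE, hU.fromSpec_app_self, Category.assoc,
      ← Functor.map_comp]
    rfl
  exact congr($h g)

theorem isLocalizing_iff {X : Scheme.{u}} (M : X.Modules) {U : X.Opens} (hU : IsAffineOpen U) :
    IsLocalizing (modulesSpecToSheaf.obj (M.restrict hU.fromSpec)) ↔
      ∀ g : Γ(X, U), LocAt M g le_rfl (X.basicOpen_le g) := by
  refine forall_congr' fun g ↦ ?_
  have e1 : hU.fromSpec ''ᵁ ⊤ = U := by simp
  have e2 : hU.fromSpec ''ᵁ (PrimeSpectrum.basicOpen g) = X.basicOpen g :=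
    hU.fromSpec_image_basicOpen g
  have key : ∀ (V W : X.Opens) (hV : V ≤ U) (hW : W ≤ V) (_ : V = U) (_ : W = X.basicOpen g),
      LocAt M g le_rfl (X.basicOpen_le g) ↔ LocAt M g hV hW := by
    rintro V W hV hW rfl rfl; rfl
  rw [key _ _ (image_fromSpec_le hU _) (Scheme.Hom.image_mono _ le_top) e1 e2]
  let N := M.restrict hU.fromSpec
  let φ := ((modulesSpecToSheaf.obj N).obj.map (PrimeSpectrum.basicOpen g).leTop.op).hom
  have hpow : ∀ (V : (Spec Γ(X, U)).Opens) (n : ℕ) (x : Γ(N, V)),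
      (M.restrictAppIso hU.fromSpec V).hom (g ^ n • x) =
        (X.presheaf.map (homOfLE (image_fromSpec_le hU V)).op g) ^ n •
          (M.restrictAppIso hU.fromSpec V).hom x := by
    intro V n x
    rw [smul_restrict_fromSpec, map_pow]
  constructor
  · intro h
    have h' : IsLocalizedModule.Away g φ := h
    refine ⟨fun s ↦ ?_, fun t ht ↦ ?_⟩
    · obtain ⟨n, t, ht⟩ := h'.surj _ _ s
      exact ⟨n, t, ht.symm.trans (hpow _ n s)⟩
    · obtain ⟨⟨_, n, rfl⟩, hn⟩ := (IsLocalizedModule.eq_zero_iff (.powers g) φ).mp ht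
      exact ⟨n, (hpow _ n t).symm.trans hn⟩
  · intro h
    change IsLocalizedModule.Away g φ
    refine IsLocalizedModule.Away.mk_of_addCommGroup ?_ (fun s ↦ ?_) (fun t ht ↦ ?_)
    · exact Scheme.Modules.isUnit_algebraMap_end_of_le_basicOpen (M := N) g le_rfl
    · obtain ⟨n, t, ht⟩ := h.1 s
      exact ⟨n, t, (hpow _ n s).trans ht.symm⟩
    · obtain ⟨n, hn⟩ := h.2 t ht
      exact ⟨n, (hpow _ n t).trans hn⟩


/-- Transport of a presentation along an isomorphism of sheaves of modules on a scheme. -/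
noncomputable def presOfIso {X : Scheme.{u}} {M N : X.Modules} (e : M ≅ N) (p : M.Presentation) :
    N.Presentation :=
  @SheafOfModules.Presentation.ofIsIso _ _ _ _ _ _ _ _ e.hom e.isIso_hom p

theorem isQuasicoherent_restrict {X : Scheme.{u}} (M : X.Modules) {U : X.Opens}
    (hU : IsAffineOpen U) (h : (M.restrict hU.fromSpec).IsQuasicoherent) :
    (M.over U).IsQuasicoherent := by
  let N := M.restrict hU.fromSpec
  have hN : IsIso N.fromTildeΓ := (isQuasicoherent_iff_isIso_fromTildeΓ N).mp h
  let p₀ : N.Presentation := presOfIso (asIso N.fromTildeΓ)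
    (presentationTilde.{u} _ Set.univ (by simp) _ (Submodule.span_eq _))
  let p₁ : (N.restrict hU.isoSpec.hom).Presentation :=
    Scheme.Modules.presentationRestrict hU.isoSpec.hom p₀
  let i₁ : Scheme.Modules.restrictFunctor hU.fromSpec ⋙
      Scheme.Modules.restrictFunctor hU.isoSpec.hom ≅ Scheme.Modules.restrictFunctor U.ι :=
    (Scheme.Modules.restrictFunctorComp _ _).symm ≪≫
      Scheme.Modules.restrictFunctorCongr hU.isoSpec_hom_fromSpec
  let p₂ : (M.restrict U.ι).Presentation := presOfIso (i₁.app M) p₁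
  let E := Scheme.Modules.overEquiv U
  have hE : PreservesColimitsOfSize.{u, u} E.inverse := inferInstance
  let p₃ := @SheafOfModules.Presentation.map _ _ _ _ _ _ _ _ _ _ _ _ _ p₂ E.inverse hE
    (U.sheafOfModulesEquivOverInverseUnit X.ringCatSheaf).symm
  let i₃ : E.inverse.obj (M.restrict U.ι) ≅ M.over U :=
    E.inverse.mapIso ((Scheme.Modules.overFunctorEquiv U).symm.app M) ≪≫
      (E.unitIso.app (M.over U)).symm
  exact (SheafOfModules.Presentation.ofIsIso.{u, u, u} i₃.hom p₃).isQuasicoherent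

theorem isQuasicoherent_iff {X : Scheme.{u}} (M : X.Modules) :
    M.IsQuasicoherent ↔ ∀ (U : X.Opens), IsAffineOpen U →
      ∀ g : Γ(X, U), LocAt M g le_rfl (X.basicOpen_le g) := by
  constructor
  · intro h U hU
    rw [← isLocalizing_iff M hU, ← isIso_fromTildeΓ_iff_isLocalizing,
      ← isQuasicoherent_iff_isIso_fromTildeΓ]
    infer_instance
  · intro h
    have (U : X.affineOpens) : (M.over U.1).IsQuasicoherent := by
      refine isQuasicoherent_restrict M U.2 ?_
      rw [isQuasicoherent_iff_isIso_fromTildeΓ, isIso_fromTildeΓ_iff_isLocalizing]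
      exact (isLocalizing_iff M U.2).mpr (h U.1 U.2)
    refine SheafOfModules.IsQuasicoherent.of_coversTop M (fun U : X.affineOpens ↦ U.1) ?_
    rw [Opens.coversTop_iff]
    exact iSup_affineOpens_eq_top X

theorem isQuasicoherent_iff_restrict {X : Scheme.{u}} (M : X.Modules) :
    M.IsQuasicoherent ↔ ∀ (U : X.Opens) (hU : IsAffineOpen U),
      (M.restrict hU.fromSpec).IsQuasicoherent := by
  refine ⟨fun h U hU ↦ inferInstance, fun h ↦ (isQuasicoherent_iff M).mpr fun U hU ↦ ?_⟩
  rw [← isLocalizing_iff M hU, ← isIso_fromTildeΓ_iff_isLocalizing,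
    ← isQuasicoherent_iff_isIso_fromTildeΓ]
  exact h U hU

theorem isQuasicoherent_cokernel_Spec {R : CommRingCat.{u}} {A B : (Spec R).Modules} (f : A ⟶ B)
    (hA : A.IsQuasicoherent) (hB : B.IsQuasicoherent) {C : (Spec R).Modules} (π : B ⟶ C)
    (w : f ≫ π = 0) (hc : IsColimit (CokernelCofork.ofπ π w)) : C.IsQuasicoherent := by
  rw [isQuasicoherent_iff_isIso_fromTildeΓ, isIso_fromTildeΓ_iff]
  obtain ⟨A', ⟨eA⟩⟩ := isIso_fromTildeΓ_iff.mp ((isQuasicoherent_iff_isIso_fromTildeΓ A).mp hA)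
  obtain ⟨B', ⟨eB⟩⟩ := isIso_fromTildeΓ_iff.mp ((isQuasicoherent_iff_isIso_fromTildeΓ B).mp hB)
  let ψ := (tilde.functor R).preimage (eA.hom ≫ f ≫ eB.inv)
  have hψ : (tilde.functor R).map ψ ≫ eB.hom = eA.hom ≫ f := by
    rw [Functor.map_preimage, Category.assoc, Category.assoc, Iso.inv_hom_id, Category.comp_id]
  exact ⟨cokernel ψ, ⟨PreservesCokernel.iso (tilde.functor R) ψ ≪≫
    cokernel.mapIso _ _ eA eB hψ ≪≫ (cokernelIsCokernel f).coconePointUniqueUpToIso hc⟩⟩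

theorem app_top_surjective_Spec {R : CommRingCat.{u}} {A B : (Spec R).Modules} (f : A ⟶ B)
    (hA : A.IsQuasicoherent) (hB : B.IsQuasicoherent) [Epi f] :
    Function.Surjective (f.app ⊤) := by
  let P := SheafOfModules.isQuasicoherent (Spec R).ringCatSheaf
  let f' : (⟨A, hA⟩ : P.FullSubcategory) ⟶ ⟨B, hB⟩ := ObjectProperty.homMk f
  have : Epi (P.ι.map f') := ‹Epi f›
  have : Epi f' := P.ι.epi_of_epi_map this
  have h : Epi ((tildeEquiv (R := R)).inverse.map f') := inferInstance
  exact (ModuleCat.epi_iff_surjective ((tildeEquiv (R := R)).inverse.map f')).mp h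

theorem app_surjective {X : Scheme.{u}} {M N : X.Modules} (f : M ⟶ N)
    (hM : M.IsQuasicoherent) (hN : N.IsQuasicoherent) [Epi f] (U : X.Opens)
    (hU : IsAffineOpen U) : Function.Surjective (f.app U) := by
  have e1 : hU.fromSpec ''ᵁ ⊤ = U := by simp
  have h : Function.Surjective
      (((Scheme.Modules.restrictFunctor hU.fromSpec).map f).app ⊤) :=
    app_top_surjective_Spec _ inferInstance inferInstance
  have h' : Function.Surjective (f.app (hU.fromSpec ''ᵁ ⊤)) := h
  rwa [e1] at h'

/-- The property of being a coherent sheaf, on a locally Noetherian scheme: quasi-coherent, and the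
sections over every affine open `U` form a finite `Γ(X, U)`-module. -/
def isCoherent (X : Scheme.{u}) : ObjectProperty X.Modules := fun M ↦
  M.IsQuasicoherent ∧ ∀ U : X.Opens, IsAffineOpen U → Module.Finite Γ(X, U) Γ(M, U)


theorem app_map {X : Scheme.{u}} {M N : X.Modules} (f : M ⟶ N) {V W : X.Opens} (h : W ≤ V)
    (x : Γ(M, V)) : f.app W (M.presheaf.map (homOfLE h).op x) =
      N.presheaf.map (homOfLE h).op (f.app V x) :=
  congr($(f.mapPresheaf.naturality (homOfLE h).op) x)

theorem app_smul {X : Scheme.{u}} {M N : X.Modules} (f : M ⟶ N) {U : X.Opens} (r : Γ(X, U))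
    (x : Γ(M, U)) : f.app U (r • x) = r • f.app U x :=
  Scheme.Modules.Hom.app_smul f r x

/-- A morphism of sheaves of modules on sections over `U`, as a linear map. -/
noncomputable def appₗ {X : Scheme.{u}} {M N : X.Modules} (f : M ⟶ N) (U : X.Opens) :
    Γ(M, U) →ₗ[Γ(X, U)] Γ(N, U) where
  toFun := f.app U
  map_add' := map_add _
  map_smul' r x := app_smul f r x

theorem map_smul_LE {X : Scheme.{u}} (M : X.Modules) {V W : X.Opens} (h : W ≤ V)
    (r : Γ(X, V)) (x : Γ(M, V)) : M.presheaf.map (homOfLE h).op (r • x) =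
      X.presheaf.map (homOfLE h).op r • M.presheaf.map (homOfLE h).op x :=
  Scheme.Modules.map_smul _ _ _ _

theorem map_map_LE {X : Scheme.{u}} {U V W : X.Opens} (h : V ≤ U) (h' : W ≤ V) (r : Γ(X, U)) :
    X.presheaf.map (homOfLE h').op (X.presheaf.map (homOfLE h).op r) =
      X.presheaf.map (homOfLE (h'.trans h)).op r := by
  rw [← ConcreteCategory.comp_apply, ← Functor.map_comp]
  rfl

/-- Sections of a kernel. -/
theorem kernel_sections {X : Scheme.{u}} {K M N : X.Modules} (i : K ⟶ M) (f : M ⟶ N)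
    (w : i ≫ f = 0) (hK : IsLimit (KernelFork.ofι i w)) (U : X.Opens) :
    Function.Injective (i.app U) ∧ ∀ x : Γ(M, U), f.app U x = 0 → ∃ y, i.app U y = x := by
  let F : X.Modules ⥤ Ab.{u} := Scheme.Modules.toPresheaf X ⋙ (evaluation _ _).obj (op U)
  have h0 : PreservesLimits (evaluation (Opens X)ᵒᵖ Ab.{u} |>.obj (op U)) := inferInstance
  have hF' : PreservesLimits F :=
    @comp_preservesLimits _ _ _ _ _ _ (Scheme.Modules.toPresheaf X) _ inferInstance h0
  have hK' := KernelFork.mapIsLimit _ hK F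
  have hF : F.PreservesZeroMorphisms := inferInstance
  have h1 : ((ShortComplex.mk i f w).map F).Exact := ShortComplex.exact_of_f_is_kernel _ hK'
  have h2 : Mono i := mono_of_isLimit_fork hK
  have h3 : Mono (F.map i) := inferInstance
  refine ⟨(AddCommGrpCat.mono_iff_injective _).mp h3, fun x hx ↦ ?_⟩
  exact (ShortComplex.ab_exact_iff _).mp h1 x hx

theorem isCoherent_kernel {X : Scheme.{u}} [IsLocallyNoetherian X] {K M N : X.Modules}
    (i : K ⟶ M) (f : M ⟶ N) (w : i ≫ f = 0) (hK : IsLimit (KernelFork.ofι i w))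
    (hM : isCoherent X M) (hN : isCoherent X N) : isCoherent X K := by
  have hs := kernel_sections i f w hK
  refine ⟨(isQuasicoherent_iff K).mpr fun U hU g ↦ ?_, fun U hU ↦ ?_⟩
  · have hM' := (isQuasicoherent_iff M).mp hM.1 U hU g
    have hN' := (isQuasicoherent_iff N).mp hN.1 U hU g
    refine ⟨fun s ↦ ?_, fun t ht ↦ ?_⟩
    · obtain ⟨n, t, ht⟩ := hM'.1 (i.app _ s)
      have h0 : f.app (X.basicOpen g) (i.app (X.basicOpen g) s) = 0 := by
        rw [← ConcreteCategory.comp_apply, ← Scheme.Modules.Hom.comp_app, w]; rfl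
      obtain ⟨m, hm⟩ := hN'.2 (f.app U t) (by rw [← app_map, ht, app_smul, h0, smul_zero])
      obtain ⟨y, hy⟩ := (hs U).2 (X.presheaf.map (homOfLE le_rfl).op g ^ m • t)
        (by rw [app_smul, hm])
      refine ⟨m + n, y, (hs _).1 ?_⟩
      rw [app_map, hy, map_smul_LE, ht, app_smul, map_pow, map_map_LE, smul_smul, ← pow_add]
    · obtain ⟨n, hn⟩ := hM'.2 (i.app _ t) (by rw [← app_map, ht, map_zero])
      exact ⟨n, (hs _).1 (by rw [app_smul, hn, map_zero])⟩
  · have := hM.2 U hU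
    have : IsNoetherianRing Γ(X, U) := IsLocallyNoetherian.component_noetherian ⟨U, hU⟩
    exact Module.Finite.of_injective (appₗ i U) (hs U).1

theorem isCoherent_cokernel {X : Scheme.{u}} {M N Q : X.Modules}
    (f : M ⟶ N) (π : N ⟶ Q) (w : f ≫ π = 0) (hQ : IsColimit (CokernelCofork.ofπ π w))
    (hM : isCoherent X M) (hN : isCoherent X N) : isCoherent X Q := by
  obtain ⟨hM, -⟩ := hM
  obtain ⟨hN, hN'⟩ := hN
  have hQ' : Q.IsQuasicoherent := by
    rw [isQuasicoherent_iff_restrict]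
    intro U hU
    have hc := CokernelCofork.mapIsColimit _ hQ (Scheme.Modules.restrictFunctor hU.fromSpec)
    refine isQuasicoherent_cokernel_Spec _ inferInstance inferInstance _ ?_ hc
    rw [← Functor.map_comp]
    exact (congrArg _ w).trans (Functor.map_zero _ _ _)
  have : Epi π := epi_of_isColimit_cofork hQ
  refine ⟨hQ', fun U hU ↦ ?_⟩
  have := hN' U hU
  exact Module.Finite.of_surjective (appₗ π U) (app_surjective π hN hQ' U hU)

theorem isCoherent_of_decomp {X : Scheme.{u}} {A B C : X.Modules} (i : A ⟶ C) (p : C ⟶ A)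
    (j : B ⟶ C) (q : C ⟶ B) (h : p ≫ i + q ≫ j = 𝟙 C) (hA : isCoherent X A)
    (hB : isCoherent X B) : isCoherent X C := by
  have hd (U : X.Opens) (x : Γ(C, U)) : i.app U (p.app U x) + j.app U (q.app U x) = x :=
    congr($(congrArg (fun k : C ⟶ C ↦ k.app U) h) x)
  refine ⟨(isQuasicoherent_iff C).mpr fun U hU g ↦ ?_, fun U hU ↦ ?_⟩
  · have hA' := (isQuasicoherent_iff A).mp hA.1 U hU g
    have hB' := (isQuasicoherent_iff B).mp hB.1 U hU g
    refine ⟨fun s ↦ ?_, fun t ht ↦ ?_⟩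
    · obtain ⟨m, a, ha⟩ := hA'.1 (p.app _ s)
      obtain ⟨n, b, hb⟩ := hB'.1 (q.app _ s)
      refine ⟨m + n, i.app U (X.presheaf.map (homOfLE le_rfl).op g ^ n • a) +
        j.app U (X.presheaf.map (homOfLE le_rfl).op g ^ m • b), ?_⟩
      rw [map_add, ← app_map, ← app_map, map_smul_LE, map_smul_LE, ha, hb, map_pow, map_pow,
        map_map_LE, smul_smul, smul_smul, ← pow_add, ← pow_add, add_comm n m, app_smul, app_smul,
        ← smul_add, hd]
    · obtain ⟨m, hm⟩ := hA'.2 (p.app _ t) (by rw [← app_map, ht, map_zero])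
      obtain ⟨n, hn⟩ := hB'.2 (q.app _ t) (by rw [← app_map, ht, map_zero])
      refine ⟨m + n, ?_⟩
      have hm' := congrArg (i.app U) hm
      have hn' := congrArg (j.app U) hn
      rw [app_smul, map_zero] at hm' hn'
      rw [← hd U (_ • t), app_smul, app_smul, app_smul, app_smul, pow_add, mul_smul, mul_smul,
        hn', smul_comm, hm']
      simp only [smul_zero, add_zero]
  · have := hA.2 U hU
    have := hB.2 U hU
    refine Module.Finite.of_surjective ((appₗ i U).coprod (appₗ j U)) fun x ↦
      ⟨(p.app U x, q.app U x), ?_⟩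
    simpa using! hd U x

theorem isCoherent_of_isZero {X : Scheme.{u}} {M : X.Modules} (hM : IsZero M) :
    isCoherent X M := by
  have h (U : X.Opens) (x : Γ(M, U)) : x = 0 :=
    congr($(congrArg (fun k : M ⟶ M ↦ k.app U) (hM.eq_of_src (𝟙 M) 0)) x)
  refine ⟨(isQuasicoherent_iff M).mpr fun U hU g ↦ ⟨fun s ↦ ⟨0, 0, ?_⟩, fun t _ ↦ ⟨0, h _ _⟩⟩,
    fun U hU ↦ ?_⟩
  · rw [h _ s, map_zero, smul_zero]
  · have : Subsingleton Γ(M, U) := ⟨fun x y ↦ (h U x).trans (h U y).symm⟩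
    infer_instance

instance (X : Scheme.{u}) : (isCoherent X).ContainsZero where
  exists_zero :=
    have h : IsZero (⊤_ X.Modules) := (isZero_zero _).of_iso (HasZeroObject.zeroIsoTerminal).symm
    ⟨⊤_ _, h, isCoherent_of_isZero h⟩

instance (X : Scheme.{u}) [IsLocallyNoetherian X] : (isCoherent X).IsClosedUnderKernels where
  kernels_le := by
    rintro _ ⟨f, k, hk, hM, hN⟩
    exact isCoherent_kernel k.ι f k.condition (hk.ofIsoLimit (Fork.ext (Iso.refl _))) hM hN

instance (X : Scheme.{u}) : (isCoherent X).IsClosedUnderCokernels where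
  cokernels_le := by
    rintro _ ⟨f, k, hk, hM, hN⟩
    exact isCoherent_cokernel f k.π k.condition (hk.ofIsoColimit (Cofork.ext (Iso.refl _))) hM hN

instance (X : Scheme.{u}) : (isCoherent X).IsClosedUnderIsomorphisms where
  of_iso e hM := isCoherent_of_decomp e.hom e.inv e.hom 0 (by simp) hM hM

instance (X : Scheme.{u}) : (isCoherent X).IsClosedUnderFiniteProducts := by
  have : (isCoherent X).IsClosedUnderBinaryProducts := ⟨by
    rintro C ⟨p⟩
    let A := p.diag.obj ⟨WalkingPair.left⟩
    let B := p.diag.obj ⟨WalkingPair.right⟩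
    let e : C ≅ A ⊞ B := IsLimit.conePointsIsoOfNatIso p.isLimit
      (BinaryBiproduct.isLimit A B) (diagramIsoPair p.diag)
    refine isCoherent_of_decomp (A := A) (B := B) (biprod.inl ≫ e.inv) (e.hom ≫ biprod.fst)
      (biprod.inr ≫ e.inv) (e.hom ≫ biprod.snd) ?_ (p.prop_diag_obj _) (p.prop_diag_obj _)
    rw [Category.assoc, Category.assoc, ← Category.assoc biprod.fst,
      ← Category.assoc biprod.snd, ← Preadditive.comp_add, ← Preadditive.add_comp, biprod.total,
      Category.id_comp, Iso.hom_inv_id]⟩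
  exact .mk'

/-- The category `Coh(X)` of coherent sheaves on `X`. -/
abbrev Coh (X : Scheme.{u}) := (isCoherent X).FullSubcategory



theorem pushforward_smul {X Y : Scheme.{u}} (f : X ⟶ Y) (M : X.Modules) (U : Y.Opens)
    (r : Γ(Y, U)) (x : Γ((Scheme.Modules.pushforward f).obj M, U)) :
    r • x = (show Γ(M, f ⁻¹ᵁ U) from (f.app U r • (show Γ(M, f ⁻¹ᵁ U) from x))) :=
  rfl

theorem isCoherent_pushforward {X Y : Scheme.{u}} (f : X ⟶ Y) [IsFinite f] (M : X.Modules)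
    (hM : isCoherent X M) : isCoherent Y ((Scheme.Modules.pushforward f).obj M) := by
  refine ⟨(isQuasicoherent_iff _).mpr fun U hU g ↦ ?_, fun U hU ↦ ?_⟩
  · have h := (isQuasicoherent_iff M).mp hM.1 (f ⁻¹ᵁ U) (hU.preimage f) (f.app U g)
    have key : ∀ (W : X.Opens) (hW : W ≤ f ⁻¹ᵁ U) (_ : W = X.basicOpen (f.app U g)),
        LocAt M (f.app U g) le_rfl (X.basicOpen_le (f.app U g)) → LocAt M (f.app U g) le_rfl hW := by
      rintro W hW rfl h; exact h
    have h' := key (f ⁻¹ᵁ Y.basicOpen g) (Scheme.Hom.preimage_mono f (Y.basicOpen_le g))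
      (Scheme.preimage_basicOpen _ _) h
    have hg (V : Y.Opens) (hV : V ≤ U) : f.app V (Y.presheaf.map (homOfLE hV).op g) =
        X.presheaf.map (homOfLE (Scheme.Hom.preimage_mono f hV)).op (f.app U g) :=
      congr($(f.naturality (homOfLE hV).op) g)
    refine ⟨fun s ↦ ?_, fun t ht ↦ ?_⟩
    · obtain ⟨n, t, ht⟩ := h'.1 s
      refine ⟨n, t, ?_⟩
      rw [pushforward_smul, map_pow, hg]
      exact ht
    · obtain ⟨n, hn⟩ := h'.2 t ht
      refine ⟨n, ?_⟩
      rw [pushforward_smul, map_pow, hg]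
      exact hn
  · have h1 := hM.2 (f ⁻¹ᵁ U) (hU.preimage f)
    have h2 : (f.app U).hom.Finite := IsFinite.finite_app f U hU
    let := (f.app U).hom.toAlgebra
    let : Module Γ(Y, U) Γ(M, f ⁻¹ᵁ U) := Module.compHom _ (f.app U).hom
    have : IsScalarTower Γ(Y, U) Γ(X, f ⁻¹ᵁ U) Γ(M, f ⁻¹ᵁ U) := .of_algebraMap_smul fun _ _ ↦ rfl
    have : Module.Finite Γ(Y, U) Γ(X, f ⁻¹ᵁ U) := h2
    exact Module.Finite.trans (R := Γ(Y, U)) Γ(X, f ⁻¹ᵁ U) Γ(M, f ⁻¹ᵁ U)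

/-- Pushforward of coherent sheaves along a finite morphism. -/
noncomputable def pushforwardCoh {X Y : Scheme.{u}} (f : X ⟶ Y) [IsFinite f] : Coh X ⥤ Coh Y :=
  (isCoherent Y).lift ((isCoherent X).ι ⋙ Scheme.Modules.pushforward f)
    fun M ↦ isCoherent_pushforward f M.obj M.property

instance {X Y : Scheme.{u}} (f : X ⟶ Y) [IsFinite f] : (pushforwardCoh f).Additive where
  map_add := by
    intro M N a b
    ext1
    exact (Scheme.Modules.pushforward f).map_add

/-- A morphism that is surjective on sections over affine opens is an epimorphism. -/
theorem epi_of_app_surjective {X : Scheme.{u}} {M N : X.Modules} (f : M ⟶ N)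
    (h : ∀ U : X.Opens, IsAffineOpen U → Function.Surjective (f.app U)) : Epi f := by
  refine ⟨fun {Q} a b hab ↦ ?_⟩
  refine Scheme.Modules.hom_ext a b fun U ↦ ?_
  ext x
  refine TopCat.Sheaf.eq_of_locally_eq' ⟨Q.presheaf, Q.isSheaf⟩
    (fun V : {V : X.affineOpens // V.1 ≤ U} ↦ V.1.1) U (fun V ↦ homOfLE V.2) ?_ _ _ fun V ↦ ?_
  · intro p hp
    obtain ⟨_, ⟨W, hW, rfl⟩, hpW, hWU⟩ :=
      X.isBasis_affineOpens.exists_subset_of_mem_open hp U.isOpen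
    exact Opens.mem_iSup.mpr ⟨⟨⟨W, hW⟩, hWU⟩, hpW⟩
  · change Q.presheaf.map (homOfLE V.2).op (a.app U x) = Q.presheaf.map (homOfLE V.2).op (b.app U x)
    rw [← app_map, ← app_map]
    obtain ⟨y, hy⟩ := h V.1.1 V.1.2 (N.presheaf.map (homOfLE V.2).op x)
    rw [← hy]
    exact congr($(congrArg (fun k : M ⟶ Q ↦ k.app V.1.1) hab) y)

section exactness
variable {X Y : Scheme.{u}} [IsLocallyNoetherian X] [IsLocallyNoetherian Y] (f : X ⟶ Y) [IsFinite f]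

instance : (pushforwardCoh f).PreservesEpimorphisms where
  preserves {M N} a _ := by
    have h0 := (isCoherent X).preservesEpimorphisms_ι_of_isNormalMonoCategory
    have : Epi ((isCoherent X).ι.map a) := inferInstance
    have : Epi ((isCoherent Y).ι.map ((pushforwardCoh f).map a)) :=
      epi_of_app_surjective _ fun U hU ↦
        app_surjective ((isCoherent X).ι.map a) M.property.1 N.property.1 (f ⁻¹ᵁ U) (hU.preimage f)
    exact (isCoherent Y).ι.epi_of_epi_map this

instance {M N : Coh X} (a : M ⟶ N) : PreservesLimit (parallelPair a 0) (pushforwardCoh f) := by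
  have := (isCoherent X).preservesKernels_ι a
  have : PreservesLimit (parallelPair a 0) ((isCoherent X).ι ⋙ Scheme.Modules.pushforward f) :=
    inferInstance
  have : PreservesLimit (parallelPair a 0) (pushforwardCoh f ⋙ (isCoherent Y).ι) := this
  exact preservesLimit_of_reflects_of_preserves _ (isCoherent Y).ι

instance : (pushforwardCoh f).PreservesHomology :=
  (pushforwardCoh f).preservesHomology_of_preservesEpis_and_kernels

instance : PreservesFiniteLimits (pushforwardCoh f) :=
  (pushforwardCoh f).preservesFiniteLimits_of_preservesHomology

instance : PreservesFiniteColimits (pushforwardCoh f) :=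
  (pushforwardCoh f).preservesFiniteColimits_of_preservesHomology

end exactness


noncomputable instance (X : Scheme.{u}) [IsLocallyNoetherian X] : HasDerivedCategory (Coh X) :=
  HasDerivedCategory.standard _

/-- The unbounded derived category `D(X)` of coherent sheaves on a locally Noetherian scheme. -/
abbrev DCoh (X : Scheme.{u}) [IsLocallyNoetherian X] := DerivedCategory (Coh X)

/-- The functor `f_* : D(X) ⥤ D(Y)` for a finite morphism `f` (e.g. a closed immersion), obtained
from the exact functor `f_*` on coherent sheaves. -/
noncomputable abbrev pushforwardD {X Y : Scheme.{u}} [IsLocallyNoetherian X]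
    [IsLocallyNoetherian Y] (f : X ⟶ Y) [IsFinite f] : DCoh X ⥤ DCoh Y :=
  (pushforwardCoh f).mapDerivedCategory

/-- The support of a sheaf of modules: the points at which the stalk is nonzero. -/
def supp {X : Scheme.{u}} (M : X.Modules) : Set X :=
  {x | Nontrivial (TopCat.Presheaf.stalk M.presheaf x : Ab.{u})}

/-- `Coh_{≤ d}(X)`: coherent sheaves whose support has dimension at most `d`
(the empty support of the zero sheaf has dimension `⊥`). -/
def cohLE (X : Scheme.{u}) (d : ℕ) : ObjectProperty (Coh X) := fun E ↦
  topologicalKrullDim (supp E.obj) ≤ (d : WithBot ℕ∞)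

/-- `Coh_{≥ d + 1}(X)`: coherent sheaves receiving no nonzero morphism from `Coh_{≤ d}(X)`. -/
def cohGE (X : Scheme.{u}) (d : ℕ) : ObjectProperty (Coh X) := fun E ↦
  ∀ F : Coh X, cohLE X d F → ∀ φ : F ⟶ E, φ = 0

/-- The heart `𝒜ᵖ(X) = ⟨Coh_{≤ 1}(X), Coh_{≥ 2}(X)[1]⟩`, as a full subcategory of `D(X)`: the objects
`E` with `H⁰(E) ∈ Coh_{≤ 1}(X)`, `H⁻¹(E) ∈ Coh_{≥ 2}(X)` and all other cohomology sheaves zero. -/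
def heart (X : Scheme.{u}) [IsLocallyNoetherian X] : ObjectProperty (DCoh X) := fun E ↦
  cohLE X 1 ((DerivedCategory.homologyFunctor (Coh X) 0).obj E) ∧
  cohGE X 1 ((DerivedCategory.homologyFunctor (Coh X) (-1)).obj E) ∧
  ∀ i : ℤ, i ≠ 0 → i ≠ -1 → IsZero ((DerivedCategory.homologyFunctor (Coh X) i).obj E)

/-- Projective space `ℙⁿ` over a field. -/
noncomputable def projectiveSpace (k : Type u) [Field k] (n : ℕ) : Scheme.{u} :=
  letI := MvPolynomial.gradedAlgebra (σ := Fin (n + 1)) (R := k)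
  Proj (MvPolynomial.homogeneousSubmodule (Fin (n + 1)) k)

/-- The structure morphism of `ℙⁿ`. -/
noncomputable def projectiveSpaceToSpec (k : Type u) [Field k] (n : ℕ) :
    projectiveSpace k n ⟶ Spec (.of k) :=
  letI := MvPolynomial.gradedAlgebra (σ := Fin (n + 1)) (R := k)
  Proj.toSpecZero (MvPolynomial.homogeneousSubmodule (Fin (n + 1)) k) ≫
    Spec.map (CommRingCat.ofHom
      (algebraMap k (MvPolynomial.homogeneousSubmodule (Fin (n + 1)) k 0)))

/-- `X`, with structure morphism `s`, is a smooth projective three-fold over the field `k`. -/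
class IsSmoothProjectiveThreefold {k : Type u} [Field k] {X : Scheme.{u}}
    (s : X ⟶ Spec (.of k)) : Prop where
  smooth : Smooth s
  projective : ∃ (n : ℕ) (i : X ⟶ projectiveSpace k n),
    IsClosedImmersion i ∧ i ≫ projectiveSpaceToSpec k n = s
  integral : IsIntegral X
  dim : topologicalKrullDim X = 3

instance {k : Type u} [Field k] {X : Scheme.{u}} (s : X ⟶ Spec (.of k))
    [h : IsSmoothProjectiveThreefold s] : LocallyOfFiniteType s :=
  have := h.smooth
  inferInstance

section baseChange
variable {k : Type u} [Field k] {X : Scheme.{u}} (s : X ⟶ Spec (.of k))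

/-- `X ⊗_k A` for a `k`-algebra `A`. -/
noncomputable def baseChange (A : Type u) [CommRing A] [Algebra k A] : Scheme.{u} :=
  pullback s (Spec.map (CommRingCat.ofHom (algebraMap k A)))

theorem specMap_comp {A B : Type u} [CommRing A] [Algebra k A] [CommRing B] [Algebra k B]
    (φ : A →ₐ[k] B) : Spec.map (CommRingCat.ofHom (φ : A →+* B)) ≫
      Spec.map (CommRingCat.ofHom (algebraMap k A)) =
      Spec.map (CommRingCat.ofHom (algebraMap k B)) := by
  rw [← Spec.map_comp, ← CommRingCat.ofHom_comp, AlgHom.comp_algebraMap]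

/-- The morphism `X ⊗_k B ⟶ X ⊗_k A` induced by a homomorphism `A → B` of `k`-algebras. -/
noncomputable def baseChangeMap {A B : Type u} [CommRing A] [Algebra k A] [CommRing B]
    [Algebra k B] (φ : A →ₐ[k] B) : baseChange s B ⟶ baseChange s A :=
  pullback.map _ _ _ _ (𝟙 X) (Spec.map (CommRingCat.ofHom (φ : A →+* B))) (𝟙 _) (by simp)
    (by rw [Category.comp_id, specMap_comp])

theorem isClosedImmersion_baseChangeMap {A B : Type u} [CommRing A] [Algebra k A] [CommRing B]
    [Algebra k B] (φ : A →ₐ[k] B) (hφ : Function.Surjective φ) :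
    IsClosedImmersion (baseChangeMap s φ) := by
  have h1 : IsClosedImmersion (Spec.map (CommRingCat.ofHom (φ : A →+* B))) :=
    IsClosedImmersion.spec_of_surjective _ hφ
  have big : IsPullback (baseChangeMap s φ ≫ pullback.fst s _)
      (pullback.snd s (Spec.map (CommRingCat.ofHom (algebraMap k B)))) s
      (Spec.map (CommRingCat.ofHom (φ : A →+* B)) ≫
        Spec.map (CommRingCat.ofHom (algebraMap k A))) := by
    rw [specMap_comp]
    have e : baseChangeMap s φ ≫ pullback.fst s _ = pullback.fst s _ :=
      (pullback.lift_fst _ _ _).trans (Category.comp_id _)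
    rw [e]
    exact IsPullback.of_hasPullback s (Spec.map (CommRingCat.ofHom (algebraMap k B)))
  have sq : IsPullback (baseChangeMap s φ)
      (pullback.snd s (Spec.map (CommRingCat.ofHom (algebraMap k B))))
      (pullback.snd s (Spec.map (CommRingCat.ofHom (algebraMap k A))))
      (Spec.map (CommRingCat.ofHom (φ : A →+* B))) :=
    IsPullback.of_right big (pullback.lift_snd _ _ _)
      (IsPullback.of_hasPullback s (Spec.map (CommRingCat.ofHom (algebraMap k A))))
  exact MorphismProperty.of_isPullback sq.flip h1

instance (A : Type u) [CommRing A] [IsNoetherianRing A] [Algebra k A] [LocallyOfFiniteType s] :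
    IsLocallyNoetherian (baseChange s A) := by
  unfold baseChange; infer_instance

variable {R : Type u} [CommRing R] [Algebra k R] (π : R)

/-- `X_m = X ⊗_k R/π^m`. -/
noncomputable abbrev thickening (m : ℕ) : Scheme.{u} :=
  baseChange s (R ⧸ Ideal.span {π ^ m})

/-- The closed immersion `ι_m : X_m ⟶ X_R`. -/
noncomputable def iota (m : ℕ) : thickening s π m ⟶ baseChange s R :=
  baseChangeMap s (Ideal.Quotient.mkₐ k (Ideal.span {π ^ m}))

/-- The closed immersion `ι_{m,m'} : X_{m'} ⟶ X_m`, for `m' ≤ m`. -/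
noncomputable def iota' (m m' : ℕ) (h : m' ≤ m) : thickening s π m' ⟶ thickening s π m :=
  baseChangeMap s (Ideal.Quotient.factorₐ k
    (Ideal.span_singleton_le_span_singleton.mpr (pow_dvd_pow π h)))

instance (m : ℕ) : IsClosedImmersion (iota s π m) :=
  isClosedImmersion_baseChangeMap s _ (Ideal.Quotient.mkₐ_surjective _ _)

instance (m m' : ℕ) (h : m' ≤ m) : IsClosedImmersion (iota' s π m m' h) :=
  isClosedImmersion_baseChangeMap s _ fun x ↦ by
    obtain ⟨y, rfl⟩ := Ideal.Quotient.mk_surjective x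
    exact ⟨Ideal.Quotient.mk _ y, rfl⟩

end baseChange

end PTCoh

open PTCoh

/-! Both closed immersions are base changes of a surjection of rings with principal kernel, so each
is cut out by one global function `a`, the image of a power of `π`. Let `F` be the pushforward of
coherent sheaves along such an immersion `j : Z ⟶ Y`. It is exact and fully faithful, and a coherent
sheaf on `Y` lies in its essential image exactly when multiplication by `a`, a natural endomorphism
`τ` of the identity functor, vanishes on it (`IsCutOutBy.mulCoh_app_eq_zero_iff`). The rest of the
Hom comparison is formal: `bijective_mapDerivedCategory` shows that `F` is bijective on `Hom(A, B)`
whenever `A`, `B` have cohomology only in degrees −1, 0 and `Hom(H⁰A, H⁻¹B) = 0`. The last condition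
holds in the heart by the definition of `cohGE`.

For this formal statement, represent `A`, `B` by complexes `K`, `L` in degrees −1, 0. A morphism of
two-term complexes that vanishes in the derived category is null-homotopic through a single map from
degree 0 to degree −1 (`exists_homotopy_of_Q_map_eq_zero`). Such a homotopy lifts along the fully
faithful `F`, which gives injectivity.

For surjectivity, a roof `FK ⟵ A ⟶ FL` is replaced by a butterfly, an extension `E` of `FK⁰` by
`FL⁻¹` with compatible maps from `FK⁻¹` and to `FL⁰` (`exists_butterfly`). In general an extension
of objects of the image need not lie in the image; the obstruction is `τ` on `E`. By naturality it
factors through a map `K⁰ ⟶ L⁻¹` compatible with the differentials, that is, a map `H⁰(K) ⟶ H⁻¹(L)`,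
and this is zero (`essImage_butterfly`). So the whole butterfly descends to `Z` and supplies the
required roof.

That pushforward preserves the hearts in (b) follows from exactness, the invariance of supports
under closed immersions, and the fact that the essential image is closed under subobjects: the image
of any map into `j_* E` is again pushed forward from `Z` (`IsCutOutBy.cohGE_pushforward`). -/

namespace PTCoh

/-! ### Roofs between two-term complexes and butterflies -/

section roofs
universe v' u'
variable {D : Type u'} [Category.{v'} D] [Abelian D]

/-- For a quasi-isomorphism `s : A ⟶ K` between complexes in degrees `≤ 0`, the sequence
`A⁻¹ ⟶ A⁰ ⊞ K⁻¹ ⟶ K⁰ ⟶ 0` is exact: surjectivity. -/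
theorem exists_refinement_of_quasiIso {A K : CochainComplex D ℤ} (s : A ⟶ K) [QuasiIso s]
    [K.IsStrictlyLE 0] {T : D} (x : T ⟶ K.X 0) :
    ∃ (T' : D) (q : T' ⟶ T) (_ : Epi q) (p : T' ⟶ A.X 0) (k : T' ⟶ K.X (-1)),
      q ≫ x = p ≫ s.f 0 + k ≫ K.d (-1) 0 := by
  have h : Epi (HomologicalComplex.homologyMap s 0) := inferInstance
  rw [HomologicalComplex.epi_homologyMap_iff_up_to_refinements s (-1) 0 1 (by simp) (by simp)] at h
  obtain ⟨T', q, hq, p, -, k, e⟩ := h x ((K.isZero_of_isStrictlyLE 0 1 (by simp)).eq_of_tgt _ _)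
  exact ⟨T', q, hq, p, k, e⟩

/-- Exactness of `A⁻¹ ⟶ A⁰ ⊞ K⁻¹ ⟶ K⁰` in the middle. -/
theorem exists_refinement_of_quasiIso' {A K : CochainComplex D ℤ} (s : A ⟶ K) [QuasiIso s]
    [A.IsStrictlyLE 0] [K.IsStrictlyGE (-1)] {T : D} (p : T ⟶ A.X 0) (k : T ⟶ K.X (-1))
    (h : p ≫ s.f 0 = k ≫ K.d (-1) 0) :
    ∃ (T' : D) (q : T' ⟶ T) (_ : Epi q) (n : T' ⟶ A.X (-1)),
      q ≫ p = n ≫ A.d (-1) 0 ∧ q ≫ k = n ≫ s.f (-1) := by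
  have h0 : Mono (HomologicalComplex.homologyMap s 0) := inferInstance
  have h1 : Epi (HomologicalComplex.homologyMap s (-1)) := inferInstance
  rw [HomologicalComplex.mono_homologyMap_iff_up_to_refinements s (-1) 0 1 (by simp)
    (by simp)] at h0
  rw [HomologicalComplex.epi_homologyMap_iff_up_to_refinements s (-2) (-1) 0 (by simp)
    (by simp)] at h1
  obtain ⟨T₁, q₁, hq₁, n, hn⟩ :=
    h0 p ((A.isZero_of_isStrictlyLE 0 1 (by simp)).eq_of_tgt _ _) k h
  obtain ⟨T₂, q₂, hq₂, n', hn', y, e⟩ := h1 (q₁ ≫ k - n ≫ s.f (-1)) (by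
    rw [Preadditive.sub_comp, Category.assoc, Category.assoc, ← h, s.comm, reassoc_of% hn, sub_self])
  refine ⟨T₂, q₂ ≫ q₁, inferInstance, q₂ ≫ n + n', ?_, ?_⟩
  · rw [Preadditive.add_comp, hn', add_zero, Category.assoc, Category.assoc, hn]
  · rw [(K.isZero_of_isStrictlyGE (-1) (-2) (by simp)).eq_of_tgt y 0, zero_comp, add_zero,
      Preadditive.comp_sub, sub_eq_iff_eq_add] at e
    rw [Preadditive.add_comp, Category.assoc, e, Category.assoc, add_comm]

/-- There are no boundaries in degree −1 of `A`, so injectivity of `H⁻¹(s)` suffices. This is left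
exactness of `A⁻¹ ⟶ A⁰ ⊞ K⁻¹ ⟶ K⁰`, the acyclic mapping cone of `s`. -/
theorem eq_zero_of_quasiIso {A K : CochainComplex D ℤ} (s : A ⟶ K) [QuasiIso s]
    [A.IsStrictlyGE (-1)] {T : D} (n : T ⟶ A.X (-1)) (h : n ≫ A.d (-1) 0 = 0)
    (h' : n ≫ s.f (-1) = 0) : n = 0 := by
  have h0 : Mono (HomologicalComplex.homologyMap s (-1)) := inferInstance
  rw [HomologicalComplex.mono_homologyMap_iff_up_to_refinements s (-2) (-1) 0 (by simp)
    (by simp)] at h0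
  obtain ⟨T₁, q₁, hq₁, y, hn⟩ := h0 n h 0 (by rw [h', zero_comp])
  rw [(A.isZero_of_isStrictlyGE (-1) (-2) (by simp)).eq_of_tgt y 0, zero_comp] at hn
  exact zero_of_epi_comp q₁ hn

/-- A morphism of complexes out of a complex in degrees `-1`, `0`. -/
noncomputable def homOfTwoTerm (K L : CochainComplex D ℤ) [K.IsStrictlyGE (-1)] [K.IsStrictlyLE 0]
    [L.IsStrictlyLE 0] (a : K.X (-1) ⟶ L.X (-1)) (b : K.X 0 ⟶ L.X 0)
    (h : a ≫ L.d (-1) 0 = K.d (-1) 0 ≫ b) : K ⟶ L where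
  f i := if h : i = -1 then eqToHom (by rw [h]) ≫ a ≫ eqToHom (by rw [h]) else
    if h : i = 0 then eqToHom (by rw [h]) ≫ b ≫ eqToHom (by rw [h]) else 0
  comm' i j hij := by
    obtain rfl : i + 1 = j := hij
    by_cases h1 : i = -1
    · subst h1
      simpa using h
    · by_cases h2 : i = 0
      · subst h2
        exact (L.isZero_of_isStrictlyLE 0 (0 + 1) (by simp)).eq_of_tgt _ _
      · by_cases h3 : i < -1
        · exact (K.isZero_of_isStrictlyGE (-1) i h3).eq_of_src _ _
        · exact (K.isZero_of_isStrictlyLE 0 i (by lia)).eq_of_src _ _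

@[simp]
theorem homOfTwoTerm_f_neg_one (K L : CochainComplex D ℤ) [K.IsStrictlyGE (-1)] [K.IsStrictlyLE 0]
    [L.IsStrictlyLE 0] (a : K.X (-1) ⟶ L.X (-1)) (b : K.X 0 ⟶ L.X 0)
    (h : a ≫ L.d (-1) 0 = K.d (-1) 0 ≫ b) : (homOfTwoTerm K L a b h).f (-1) = a := by
  simp [homOfTwoTerm]

@[simp]
theorem homOfTwoTerm_f_zero (K L : CochainComplex D ℤ) [K.IsStrictlyGE (-1)] [K.IsStrictlyLE 0]
    [L.IsStrictlyLE 0] (a : K.X (-1) ⟶ L.X (-1)) (b : K.X 0 ⟶ L.X 0)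
    (h : a ≫ L.d (-1) 0 = K.d (-1) 0 ≫ b) : (homOfTwoTerm K L a b h).f 0 = b := by
  simp [homOfTwoTerm]

theorem twoTerm_hom_ext {K L : CochainComplex D ℤ} [K.IsStrictlyGE (-1)] [K.IsStrictlyLE 0]
    {f g : K ⟶ L} (h : f.f (-1) = g.f (-1)) (h' : f.f 0 = g.f 0) : f = g := by
  ext i
  by_cases h1 : i = -1
  · subst h1; exact h
  by_cases h2 : i = 0
  · subst h2; exact h'
  by_cases h3 : i < -1
  · exact (K.isZero_of_isStrictlyGE (-1) i h3).eq_of_src _ _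
  · exact (K.isZero_of_isStrictlyLE 0 i (by lia)).eq_of_src _ _

/-- A butterfly between two morphisms `dK`, `dL`, seen as complexes in degrees `-1`, `0`: an
extension `E` of `K₀` by `L₁` with a splitting over `K₁` and an extension of `dL` to `E`. -/
structure Butterfly {K₁ K₀ L₁ L₀ : D} (dK : K₁ ⟶ K₀) (dL : L₁ ⟶ L₀) where
  E : D
  lam : K₁ ⟶ E
  kap : L₁ ⟶ E
  epsK : E ⟶ K₀
  epsL : E ⟶ L₀
  lam_epsK : lam ≫ epsK = dK
  kap_epsL : kap ≫ epsL = dL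
  kap_epsK : kap ≫ epsK = 0
  lam_epsL : lam ≫ epsL = 0
  mono_kap : Mono kap
  epi_epsK : Epi epsK
  exact : (ShortComplex.mk kap epsK kap_epsK).Exact

attribute [instance] Butterfly.mono_kap Butterfly.epi_epsK

/-- A roof `K ⟵ A ⟶ L` of complexes in degrees `-1`, `0` is dominated by a butterfly. -/
theorem exists_butterfly {A K L : CochainComplex D ℤ} (s : A ⟶ K) (f : A ⟶ L) [QuasiIso s]
    [A.IsStrictlyGE (-1)] [A.IsStrictlyLE 0] [K.IsStrictlyGE (-1)] [K.IsStrictlyLE 0] :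
    ∃ (b : Butterfly (K.d (-1) 0) (L.d (-1) 0)) (p : A.X 0 ⟶ b.E),
      A.d (-1) 0 ≫ p = s.f (-1) ≫ b.lam + f.f (-1) ≫ b.kap ∧
      p ≫ b.epsK = s.f 0 ∧ p ≫ b.epsL = f.f 0 := by
  -- The cokernel of `ψ` is the universal object under `A⁰`, `K⁻¹` and `L⁻¹` in which `d n` becomes
  -- `s n + f n` for `n` in `A⁻¹`; the signs encode this relation.
  let ψ : A.X (-1) ⟶ A.X 0 ⊞ (K.X (-1) ⊞ L.X (-1)) :=
    biprod.lift (A.d (-1) 0) (biprod.lift (-s.f (-1)) (-f.f (-1)))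
  let c := cokernel.π ψ
  have hex : (ShortComplex.mk ψ c (cokernel.condition ψ)).Exact := ShortComplex.exact_cokernel ψ
  let p : A.X 0 ⟶ cokernel ψ := biprod.inl ≫ c
  let lam : K.X (-1) ⟶ cokernel ψ := biprod.inl ≫ biprod.inr ≫ c
  let kap : L.X (-1) ⟶ cokernel ψ := biprod.inr ≫ biprod.inr ≫ c
  let epsK : cokernel ψ ⟶ K.X 0 := cokernel.desc ψ
    (biprod.desc (s.f 0) (biprod.desc (K.d (-1) 0) 0)) (by simp [ψ])
  let epsL : cokernel ψ ⟶ L.X 0 := cokernel.desc ψ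
    (biprod.desc (f.f 0) (biprod.desc 0 (L.d (-1) 0))) (by simp [ψ])
  have hp : p ≫ epsK = s.f 0 := by simp [p, epsK, c]
  have hlK : lam ≫ epsK = K.d (-1) 0 := by simp [lam, epsK, c]
  have hkK : kap ≫ epsK = 0 := by simp [kap, epsK, c]
  have hd : A.d (-1) 0 ≫ p = s.f (-1) ≫ lam + f.f (-1) ≫ kap := by
    have := cokernel.condition ψ
    have e : ψ = A.d (-1) 0 ≫ biprod.inl - s.f (-1) ≫ biprod.inl ≫ biprod.inr -
        f.f (-1) ≫ biprod.inr ≫ biprod.inr := by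
      ext <;> simp [ψ]
    have h : (A.d (-1) 0 ≫ biprod.inl - s.f (-1) ≫ biprod.inl ≫ biprod.inr -
        f.f (-1) ≫ biprod.inr ≫ biprod.inr) ≫ c = 0 := by rw [← e]; exact this
    simp only [Preadditive.sub_comp, Category.assoc, sub_eq_iff_eq_add, zero_add] at h
    rw [h, add_comm]
  -- An element `l` of `L⁻¹` that dies in the cokernel comes from some `n` in `A⁻¹` with `d n = 0`
  -- and `s n = 0`. Then `n = 0`, hence `l = -f n = 0`.
  have hm : Mono kap := by
    refine (Preadditive.mono_iff_cancel_zero _).mpr fun T l hl ↦ ?_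
    obtain ⟨T', q, hq, n, hn⟩ := (ShortComplex.exact_iff_exact_up_to_refinements _).mp hex
      (l ≫ biprod.inr ≫ biprod.inr) (by simpa [kap] using hl)
    have h1 := congrArg (· ≫ biprod.fst) hn
    have h2 := congrArg (· ≫ biprod.snd ≫ biprod.fst) hn
    have h3 := congrArg (· ≫ biprod.snd ≫ biprod.snd) hn
    simp [ψ] at h1 h2 h3
    have hn0 : n = 0 := eq_zero_of_quasiIso s n h1.symm h2
    rw [hn0, zero_comp, neg_zero] at h3
    exact zero_of_epi_comp q h3
  have he : Epi epsK := by
    rw [epi_iff_surjective_up_to_refinements]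
    intro T x
    obtain ⟨T', q, hq, a, k, e⟩ := exists_refinement_of_quasiIso s x
    exact ⟨T', q, hq, a ≫ p + k ≫ lam, by simp [hp, hlK, e]⟩
  -- Write an element as the class of `(a, k, l)`. If it dies in `K⁰`, then `s a = d (-k)`, so `(a,
  -- -k)` comes from some `n` in `A⁻¹`, and the relation `hd` turns the class into the image of `f n
  -- + l`.
  have hexact : (ShortComplex.mk kap epsK hkK).Exact := by
    rw [ShortComplex.exact_iff_exact_up_to_refinements]
    intro T e he
    obtain ⟨T₁, q₁, hq₁, z, hz⟩ := surjective_up_to_refinements_of_epi c e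
    have hz' : z = (z ≫ biprod.fst) ≫ biprod.inl +
        (z ≫ biprod.snd ≫ biprod.fst) ≫ biprod.inl ≫ biprod.inr +
        (z ≫ biprod.snd ≫ biprod.snd) ≫ biprod.inr ≫ biprod.inr := by
      ext <;> simp
    generalize z ≫ biprod.fst = a at hz'
    generalize z ≫ biprod.snd ≫ biprod.fst = k at hz'
    generalize z ≫ biprod.snd ≫ biprod.snd = l at hz'
    have hz2 : q₁ ≫ e = a ≫ p + k ≫ lam + l ≫ kap := by
      rw [hz, hz']; simp [p, lam, kap]
    have h0 : a ≫ s.f 0 = (-k) ≫ K.d (-1) 0 := by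
      have := congrArg (· ≫ epsK) hz2
      simp only [Category.assoc, Preadditive.add_comp, hp, hlK, hkK, comp_zero, add_zero] at this
      dsimp at he
      rw [he, comp_zero] at this
      rw [Preadditive.neg_comp]
      exact eq_neg_of_add_eq_zero_left this.symm
    obtain ⟨T₂, q₂, hq₂, n, hn, hn'⟩ := exists_refinement_of_quasiIso' s a (-k) h0
    refine ⟨T₂, q₂ ≫ q₁, inferInstance, n ≫ f.f (-1) + q₂ ≫ l, ?_⟩
    have hk : q₂ ≫ k = - (n ≫ s.f (-1)) := by rw [← hn']; simp
    dsimp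
    rw [Category.assoc, hz2]
    simp only [Preadditive.comp_add, Preadditive.add_comp, Category.assoc]
    rw [reassoc_of% hn, reassoc_of% hk, hd]
    simp
  exact ⟨⟨cokernel ψ, lam, kap, epsK, epsL, hlK, by simp [kap, epsL, c], hkK,
    by simp [lam, epsL, c], hm, he, hexact⟩, p, hd, hp, by simp [p, epsL, c]⟩

/-- The complex `K⁻¹ ⊞ L⁻¹ ⟶ E` of a butterfly. -/
noncomputable def Butterfly.complex {K L : CochainComplex D ℤ} (b : Butterfly (K.d (-1) 0) (L.d (-1) 0)) :
    CochainComplex D ℤ :=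
  HomologicalComplex.double (c := ComplexShape.up ℤ) (i₀ := -1) (i₁ := 0)
    (biprod.desc b.lam b.kap) (by simp)

instance {K L : CochainComplex D ℤ} (b : Butterfly (K.d (-1) 0) (L.d (-1) 0)) : b.complex.IsStrictlyGE (-1) := by
  rw [CochainComplex.isStrictlyGE_iff]
  intro i hi
  exact HomologicalComplex.isZero_double_X _ _ _ (by lia) (by lia)

instance {K L : CochainComplex D ℤ} (b : Butterfly (K.d (-1) 0) (L.d (-1) 0)) : b.complex.IsStrictlyLE 0 := by
  rw [CochainComplex.isStrictlyLE_iff]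
  intro i hi
  exact HomologicalComplex.isZero_double_X _ _ _ (by lia) (by lia)

noncomputable def Butterfly.i₀ {K L : CochainComplex D ℤ} (b : Butterfly (K.d (-1) 0) (L.d (-1) 0)) :
    b.complex.X (-1) ≅ K.X (-1) ⊞ L.X (-1) := HomologicalComplex.doubleXIso₀ _ _

noncomputable def Butterfly.i₁ {K L : CochainComplex D ℤ} (b : Butterfly (K.d (-1) 0) (L.d (-1) 0)) :
    b.complex.X 0 ≅ b.E := HomologicalComplex.doubleXIso₁ _ _ (by simp)

theorem Butterfly.complex_d {K L : CochainComplex D ℤ} (b : Butterfly (K.d (-1) 0) (L.d (-1) 0)) :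
    b.complex.d (-1) 0 = b.i₀.hom ≫ biprod.desc b.lam b.kap ≫ b.i₁.inv :=
  HomologicalComplex.double_d _ _ _

noncomputable def Butterfly.toK {K L : CochainComplex D ℤ} [K.IsStrictlyLE 0] (b : Butterfly (K.d (-1) 0) (L.d (-1) 0)) :
    b.complex ⟶ K :=
  homOfTwoTerm _ _ (b.i₀.hom ≫ biprod.fst) (b.i₁.hom ≫ b.epsK) (by
    rw [b.complex_d]
    simp only [Category.assoc, Iso.inv_hom_id_assoc, Iso.cancel_iso_hom_left]
    ext <;> simp [b.lam_epsK, b.kap_epsK])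

noncomputable def Butterfly.toL {K L : CochainComplex D ℤ} [L.IsStrictlyLE 0] (b : Butterfly (K.d (-1) 0) (L.d (-1) 0)) :
    b.complex ⟶ L :=
  homOfTwoTerm _ _ (b.i₀.hom ≫ biprod.snd) (b.i₁.hom ≫ b.epsL) (by
    rw [b.complex_d]
    simp only [Category.assoc, Iso.inv_hom_id_assoc, Iso.cancel_iso_hom_left]
    ext <;> simp [b.lam_epsL, b.kap_epsL])

/-- The map is a termwise epimorphism whose kernel is a copy of `L⁻¹` in both degrees with
invertible differential, because `kap` identifies `L⁻¹` with the kernel of `epsK`. The kernel is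
therefore acyclic. -/
instance {K L : CochainComplex D ℤ} [K.IsStrictlyGE (-1)] [K.IsStrictlyLE 0] (b : Butterfly (K.d (-1) 0) (L.d (-1) 0)) :
    QuasiIso b.toK := by
  have hK := (ShortComplex.exact_iff_exact_up_to_refinements _).mp b.exact
  dsimp at hK
  have key (i : ℤ) (h1 : Mono (HomologicalComplex.homologyMap b.toK i))
      (h2 : Epi (HomologicalComplex.homologyMap b.toK i)) : QuasiIsoAt b.toK i := by
    rw [quasiIsoAt_iff_isIso_homologyMap]
    exact isIso_of_mono_of_epi _
  refine ⟨fun i ↦ ?_⟩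
  by_cases hi : i = -1
  · subst hi
    apply key
    · rw [HomologicalComplex.mono_homologyMap_iff_up_to_refinements _ (-2) (-1) 0 (by simp)
        (by simp)]
      intro T x hx y hy
      refine ⟨T, 𝟙 T, inferInstance, 0, ?_⟩
      rw [(K.isZero_of_isStrictlyGE (-1) (-2) (by simp)).eq_of_tgt y 0, zero_comp] at hy
      rw [b.complex_d] at hx
      simp only [Butterfly.toK, homOfTwoTerm_f_neg_one] at hy
      have hx' : (x ≫ b.i₀.hom) ≫ biprod.desc b.lam b.kap = 0 := by
        rw [← cancel_mono b.i₁.inv]; simpa using hx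
      have e : x ≫ b.i₀.hom = ((x ≫ b.i₀.hom) ≫ biprod.snd) ≫ biprod.inr := by
        ext
        · simpa using hy
        · simp
      rw [e, Category.assoc, biprod.inr_desc] at hx'
      rw [zero_of_comp_mono _ hx', zero_comp] at e
      rw [zero_comp, Category.id_comp]
      exact zero_of_comp_mono _ e
    · rw [HomologicalComplex.epi_homologyMap_iff_up_to_refinements _ (-2) (-1) 0 (by simp)
        (by simp)]
      intro T k hk
      obtain ⟨T', q, hq, l, hl⟩ := hK (k ≫ b.lam) (by rw [Category.assoc, b.lam_epsK, hk])
      -- The image of the cycle `k` in `E` need not vanish, but it lies in `L⁻¹`, say equal to `kap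
      -- l`; subtracting `l` gives a cycle over `k`.
      refine ⟨T', q, hq, biprod.lift (q ≫ k) (-l) ≫ b.i₀.inv, ?_, 0, ?_⟩
      · simp [b.complex_d, reassoc_of% hl]
      · simp [Butterfly.toK]
  by_cases hi : i = 0
  · subst hi
    apply key
    · rw [HomologicalComplex.mono_homologyMap_iff_up_to_refinements _ (-1) 0 1 (by simp)
        (by simp)]
      intro T x hx y hy
      simp only [Butterfly.toK, homOfTwoTerm_f_zero] at hy
      obtain ⟨T', q, hq, l, hl⟩ := hK (x ≫ b.i₁.hom - y ≫ b.lam)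
        (by simp [hy, b.lam_epsK])
      refine ⟨T', q, hq, biprod.lift (q ≫ y) l ≫ b.i₀.inv, ?_⟩
      rw [b.complex_d, ← cancel_mono b.i₁.hom]
      simp only [Preadditive.comp_sub, sub_eq_iff_eq_add] at hl
      simp [hl, add_comm]
    · rw [HomologicalComplex.epi_homologyMap_iff_up_to_refinements _ (-1) 0 1 (by simp)
        (by simp)]
      intro T k hk
      obtain ⟨T', q, hq, e, he⟩ := surjective_up_to_refinements_of_epi b.epsK k
      refine ⟨T', q, hq, e ≫ b.i₁.inv, ?_, 0, ?_⟩
      · exact (b.complex.isZero_of_isStrictlyLE 0 1 (by simp)).eq_of_tgt _ _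
      · simp [Butterfly.toK, he]
  · have h (M : CochainComplex D ℤ) [M.IsStrictlyGE (-1)] [M.IsStrictlyLE 0] : M.ExactAt i := by
      by_cases h3 : i < -1
      · exact HomologicalComplex.ExactAt.of_isZero (M.isZero_of_isStrictlyGE (-1) i h3)
      · exact HomologicalComplex.ExactAt.of_isZero (M.isZero_of_isStrictlyLE 0 i (by lia))
    exact (quasiIsoAt_iff_exactAt _ _ (h _)).mpr (h _)

end roofs

/-! ### Exact fully faithful functors on derived Hom groups between two-term objects -/

section functor
universe w₁ w₂ v₁ v₂ u₁ u₂
variable {C : Type u₁} [Category.{v₁} C] [Abelian C]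
  {D : Type u₂} [Category.{v₂} D] [Abelian D]

/-- A quasi-isomorphic-to-zero morphism between two-term complexes lifts to a null-homotopy. -/
theorem exists_homotopy_of_Q_map_eq_zero [HasDerivedCategory.{w₂} D] {K L : CochainComplex D ℤ}
    [K.IsStrictlyLE 0] [L.IsStrictlyGE (-1)]
    [K.IsStrictlyGE (-1)] (f : K ⟶ L) (hf : DerivedCategory.Q.map f = 0) :
    ∃ θ : K.X 0 ⟶ L.X (-1), K.d (-1) 0 ≫ θ = f.f (-1) ∧ θ ≫ L.d (-1) 0 = f.f 0 := by
  obtain ⟨A, s, hs, h⟩ : ∃ (A : CochainComplex D ℤ) (s : A ⟶ K) (_ : QuasiIso s),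
      Nonempty (Homotopy (s ≫ f) 0) := by
    have h1 : DerivedCategory.Qh.map ((HomotopyCategory.quotient D (.up ℤ)).map f) =
        DerivedCategory.Qh.map ((HomotopyCategory.quotient D (.up ℤ)).map 0) := by
      have := hf.trans (DerivedCategory.Q.map_zero K L).symm
      exact this
    obtain ⟨A, s, hs, e⟩ := (MorphismProperty.map_eq_iff_precomp DerivedCategory.Qh
      (HomotopyCategory.quasiIso D (ComplexShape.up ℤ)) _ _).mp h1
    obtain ⟨A, rfl⟩ := HomotopyCategory.quotient_obj_surjective A
    obtain ⟨s, rfl⟩ := (HomotopyCategory.quotient _ _).map_surjective s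
    rw [HomotopyCategory.quotient_map_mem_quasiIso_iff] at hs
    rw [← Functor.map_comp, ← Functor.map_comp, comp_zero] at e
    exact ⟨A, s, hs, ⟨HomotopyCategory.homotopyOfEq _ _ e⟩⟩
  obtain ⟨h⟩ := h
  have hA : A.IsLE 0 := by
    rw [CochainComplex.isLE_iff]
    intro i hi
    exact (quasiIsoAt_iff_exactAt' s i (K.exactAt_of_isLE 0 i hi)).mp inferInstance
  -- Once the source is truncated to degrees `≤ 0`, the homotopy has a single nonzero component,
  -- from degree 0 to degree −1 of `L`.
  obtain ⟨A', s', hs', hA', h'⟩ : ∃ (A' : CochainComplex D ℤ) (s' : A' ⟶ K) (_ : QuasiIso s')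
      (_ : A'.IsStrictlyLE 0), Nonempty (Homotopy (s' ≫ f) 0) :=
    ⟨A.truncLE 0, A.ιTruncLE 0 ≫ s, inferInstance, inferInstance,
      ⟨(Homotopy.ofEq (by simp)).trans ((h.compLeft (A.ιTruncLE 0)).trans
        (Homotopy.ofEq (by simp)))⟩⟩
  clear! A
  obtain ⟨h⟩ := h'
  let h0 : A'.X 0 ⟶ L.X (-1) := h.hom 0 (-1)
  have e0 : s'.f 0 ≫ f.f 0 = h0 ≫ L.d (-1) 0 := by
    have := h.comm 0
    rw [dNext_eq h.hom (show (ComplexShape.up ℤ).Rel 0 1 by simp),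
      prevD_eq h.hom (show (ComplexShape.up ℤ).Rel (-1) 0 by simp),
      (A'.isZero_of_isStrictlyLE 0 1 (by simp)).eq_of_tgt (A'.d 0 1) 0] at this
    simpa using this
  have e1 : s'.f (-1) ≫ f.f (-1) = A'.d (-1) 0 ≫ h0 := by
    have := h.comm (-1)
    rw [dNext_eq h.hom (show (ComplexShape.up ℤ).Rel (-1) 0 by simp),
      prevD_eq h.hom (show (ComplexShape.up ℤ).Rel (-2) (-1) by simp),
      (L.isZero_of_isStrictlyGE (-1) (-2) (by simp)).eq_of_src (L.d _ _) 0] at this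
    simpa using this
  let S := ShortComplex.mk (biprod.lift (A'.d (-1) 0) (-s'.f (-1)))
    (biprod.desc (s'.f 0) (K.d (-1) 0)) (by simp)
  have hS : S.Exact := by
    rw [ShortComplex.exact_iff_exact_up_to_refinements]
    intro T x hx
    obtain ⟨T', q, hq, n, hn, hn'⟩ := exists_refinement_of_quasiIso' s' (x ≫ biprod.fst)
      (-(x ≫ biprod.snd)) (by
        have hx' : x = (x ≫ biprod.fst) ≫ biprod.inl + (x ≫ biprod.snd) ≫ biprod.inr := by
          ext <;> simp
        rw [hx'] at hx
        rw [Preadditive.neg_comp]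
        refine eq_neg_of_add_eq_zero_left ?_
        simpa [S] using hx)
    refine ⟨T', q, hq, n, ?_⟩
    ext
    · simpa [S] using hn
    · simpa [S, neg_eq_iff_eq_neg] using hn'
  have hE : Epi S.g := by
    rw [epi_iff_surjective_up_to_refinements]
    intro T x
    obtain ⟨T', q, hq, a, k, e⟩ := exists_refinement_of_quasiIso s' x
    exact ⟨T', q, hq, biprod.lift a k, by simp [S, e, biprod.lift_desc]⟩
  -- `K⁰` is the cokernel of `A'⁻¹ ⟶ A'⁰ ⊞ K⁻¹`, and by `e1` the pair `(h0, f⁻¹)` kills `A'⁻¹`. So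
  -- the homotopy, known a priori only after composing with `s'`, descends to `K` itself.
  let θ : K.X 0 ⟶ L.X (-1) := hS.desc (biprod.desc h0 (f.f (-1))) (by simp [S, e1])
  have hθ : S.g ≫ θ = biprod.desc h0 (f.f (-1)) := hS.g_desc _ _
  have t1 : s'.f 0 ≫ θ = h0 := by simpa [S] using congrArg (biprod.inl ≫ ·) hθ
  have t2 : K.d (-1) 0 ≫ θ = f.f (-1) := by simpa [S] using congrArg (biprod.inr ≫ ·) hθ
  refine ⟨θ, t2, ?_⟩
  rw [← cancel_epi S.g]
  dsimp [S]
  ext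
  · simp [reassoc_of% t1, e0]
  · simp [reassoc_of% t2]

/-- The converse of the preceding lemma: `θ`, extended by zero, is a null-homotopy, since `K` has no
terms outside degrees −1, 0. -/
theorem Q_map_eq_zero_of_homotopy [HasDerivedCategory.{w₂} D] {K L : CochainComplex D ℤ}
    [K.IsStrictlyLE 0] [K.IsStrictlyGE (-1)] (f : K ⟶ L)
    (θ : K.X 0 ⟶ L.X (-1)) (h1 : K.d (-1) 0 ≫ θ = f.f (-1)) (h0 : θ ≫ L.d (-1) 0 = f.f 0) :
    DerivedCategory.Q.map f = 0 := by
  let H (i j : ℤ) (_ : (ComplexShape.up ℤ).Rel j i) : K.X i ⟶ L.X j :=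
    if h : i = 0 ∧ j = -1 then eqToHom (by rw [h.1]) ≫ θ ≫ eqToHom (by rw [h.2]) else 0
  have e : f = Homotopy.nullHomotopicMap' H := by
    refine twoTerm_hom_ext ?_ ?_
    · rw [Homotopy.nullHomotopicMap'_f (show (ComplexShape.up ℤ).Rel (-2) (-1) by simp)
        (show (ComplexShape.up ℤ).Rel (-1) 0 by simp)]
      simp [H, h1]
    · rw [Homotopy.nullHomotopicMap'_f (show (ComplexShape.up ℤ).Rel (-1) 0 by simp)
        (show (ComplexShape.up ℤ).Rel 0 1 by simp)]
      simp [H, h0]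
  have h : (HomotopyCategory.quotient D (.up ℤ)).map f = 0 := by
    rw [e, HomotopyCategory.eq_of_homotopy _ _ (Homotopy.nullHomotopy' H), Functor.map_zero]
  have h' := congrArg DerivedCategory.Qh.map h
  rw [Functor.map_zero] at h'
  exact h'

variable (F : C ⥤ D) [F.Additive]

/-- The termwise image of a complex under an additive functor. -/
abbrev mapC (K : CochainComplex C ℤ) : CochainComplex D ℤ :=
  (F.mapHomologicalComplex (ComplexShape.up ℤ)).obj K

instance (K : CochainComplex C ℤ) (n : ℤ) [K.IsStrictlyLE n] : (mapC F K).IsStrictlyLE n := by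
  rw [CochainComplex.isStrictlyLE_iff]
  intro i hi
  exact F.map_isZero (K.isZero_of_isStrictlyLE n i hi)

instance (K : CochainComplex C ℤ) (n : ℤ) [K.IsStrictlyGE n] : (mapC F K).IsStrictlyGE n := by
  rw [CochainComplex.isStrictlyGE_iff]
  intro i hi
  exact F.map_isZero (K.isZero_of_isStrictlyGE n i hi)

/-- A morphism `K⁰ ⟶ L⁻¹` killed by the differentials factors through `H⁰(K) ⟶ H⁻¹(L)`. -/
theorem eq_zero_of_homology {K L : CochainComplex C ℤ} [K.IsStrictlyLE 0] [L.IsStrictlyGE (-1)]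
    (h : ∀ g : K.homology 0 ⟶ L.homology (-1), g = 0) (b : K.X 0 ⟶ L.X (-1))
    (h1 : K.d (-1) 0 ≫ b = 0) (h2 : b ≫ L.d (-1) 0 = 0) : b = 0 := by
  have e1 : IsIso (K.homologyι 0) := K.isIso_homologyι 0 1 (by simp)
    ((K.isZero_of_isStrictlyLE 0 1 (by simp)).eq_of_tgt _ _)
  have e2 : IsIso (L.homologyπ (-1)) := L.isIso_homologyπ (-2) (-1) (by simp)
    ((L.isZero_of_isStrictlyGE (-1) (-2) (by simp)).eq_of_src _ _)
  let c : K.opcycles 0 ⟶ L.cycles (-1) := K.descOpcycles (L.liftCycles b 0 (by simp) h2) (-1)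
    (by simp) (by rw [← cancel_mono (L.iCycles (-1))]; simpa using h1)
  have hc : K.pOpcycles 0 ≫ c ≫ L.iCycles (-1) = b := by simp [c]
  have h0 := h (K.homologyι 0 ≫ c ≫ L.homologyπ (-1))
  have : c = 0 := by
    rw [← cancel_epi (K.homologyι 0), ← cancel_mono (L.homologyπ (-1)), Category.assoc, h0]
    simp
  rw [← hc, this, zero_comp, comp_zero]

variable [F.Full] [F.Faithful]

section butterfly
variable {K₁ K₀ L₁ L₀ : C} {dK : K₁ ⟶ K₀} {dL : L₁ ⟶ L₀}

/-- Here `τ` vanishes on all four outer objects, so by naturality `τ` on `E` is killed by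
composition with every structure map of the butterfly. Hence it factors as `E ⟶ K₀ ⟶ L₁ ⟶ E`, with
middle map `c` satisfying `dK ≫ c = 0` and `c ≫ dL = 0`. Fullness and faithfulness bring `c` back to
`C`, where it is zero by hypothesis. -/
theorem essImage_butterfly {τ : 𝟭 D ⟶ 𝟭 D} (hτ : ∀ Y, τ.app Y = 0 ↔ F.essImage Y)
    (h : ∀ c : K₀ ⟶ L₁, dK ≫ c = 0 → c ≫ dL = 0 → c = 0) (b : Butterfly (F.map dK) (F.map dL)) :
    F.essImage b.E := by
  have hF (X : C) : τ.app (F.obj X) = 0 := (hτ _).mpr (F.obj_mem_essImage X)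
  have n1 : τ.app b.E ≫ b.epsK = 0 :=
    (τ.naturality b.epsK).symm.trans (by rw [hF, comp_zero])
  have n2 : τ.app b.E ≫ b.epsL = 0 :=
    (τ.naturality b.epsL).symm.trans (by rw [hF, comp_zero])
  have n3 : b.lam ≫ τ.app b.E = 0 := (τ.naturality b.lam).trans (by rw [hF, zero_comp])
  have n4 : b.kap ≫ τ.app b.E = 0 := (τ.naturality b.kap).trans (by rw [hF, zero_comp])
  let a : b.E ⟶ F.obj L₁ := b.exact.lift (τ.app b.E) n1
  have ha : a ≫ b.kap = τ.app b.E := b.exact.lift_f _ _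
  have a1 : b.lam ≫ a = 0 := zero_of_comp_mono b.kap (by rw [Category.assoc, ha, n3])
  have a2 : b.kap ≫ a = 0 := zero_of_comp_mono b.kap (by rw [Category.assoc, ha, n4])
  let c : F.obj K₀ ⟶ F.obj L₁ := b.exact.desc a a2
  have hc : b.epsK ≫ c = a := b.exact.g_desc _ _
  have c1 : F.map dK ≫ c = 0 := by rw [← b.lam_epsK, Category.assoc, hc, a1]
  have c2 : c ≫ F.map dL = 0 := by
    refine zero_of_epi_comp b.epsK ?_
    have hk : a ≫ F.map dL = a ≫ b.kap ≫ b.epsL := congrArg (a ≫ ·) b.kap_epsL.symm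
    rw [reassoc_of% hc, hk, reassoc_of% ha, n2]
  obtain ⟨c₀, hc₀⟩ := F.map_surjective c
  have hc0 : c₀ = 0 := by
    refine h c₀ (F.map_injective ?_) (F.map_injective ?_)
    · rw [Functor.map_comp, hc₀, Functor.map_zero, c1]
    · rw [Functor.map_comp, hc₀, Functor.map_zero, c2]
  rw [← hτ, ← ha, ← hc, ← hc₀, hc0, Functor.map_zero, comp_zero, zero_comp]

variable [PreservesFiniteLimits F] [PreservesFiniteColimits F]

/-- A butterfly between images, with middle term in the essential image, descends. -/
theorem Butterfly.exists_descend (b : Butterfly (F.map dK) (F.map dL)) {E : C}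
    (e : F.obj E ≅ b.E) : ∃ (b₀ : Butterfly dK dL) (e : F.obj b₀.E ≅ b.E),
      F.map b₀.lam = b.lam ≫ e.inv ∧ F.map b₀.kap = b.kap ≫ e.inv ∧
      F.map b₀.epsK = e.hom ≫ b.epsK ∧ F.map b₀.epsL = e.hom ≫ b.epsL := by
  obtain ⟨lam, h1⟩ := F.map_surjective (b.lam ≫ e.inv)
  obtain ⟨kap, h2⟩ := F.map_surjective (b.kap ≫ e.inv)
  obtain ⟨epsK, h3⟩ := F.map_surjective (e.hom ≫ b.epsK)
  obtain ⟨epsL, h4⟩ := F.map_surjective (e.hom ≫ b.epsL)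
  have h0 : kap ≫ epsK = 0 := F.map_injective (by simpa [h2, h3] using b.kap_epsK)
  refine ⟨⟨E, lam, kap, epsK, epsL, F.map_injective (by simpa [h1, h3] using b.lam_epsK),
    F.map_injective (by simpa [h2, h4] using b.kap_epsL), h0,
    F.map_injective (by simpa [h1, h4] using b.lam_epsL),
    F.mono_of_mono_map (by rw [h2]; infer_instance),
    F.epi_of_epi_map (by rw [h3]; infer_instance), ?_⟩, e, h1, h2, h3, h4⟩
  rw [← ShortComplex.exact_map_iff_of_faithful _ F]
  refine (ShortComplex.exact_iff_of_iso ?_).mp b.exact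
  refine ShortComplex.isoMk (Iso.refl _) e.symm (Iso.refl _) ?_ ?_
  · exact (Category.id_comp _).trans h2
  · exact (congrArg (e.inv ≫ ·) h3).trans
      ((e.inv_hom_id_assoc _).trans (Category.comp_id _).symm)

end butterfly

variable [PreservesFiniteLimits F] [PreservesFiniteColimits F]
  [HasDerivedCategory.{w₁} C] [HasDerivedCategory.{w₂} D]

-- The surjectivity half: a morphism between images in the derived category is represented by the
-- image of a roof, namely the one carried by a descended butterfly.
omit [HasDerivedCategory.{w₁} C] in
theorem exists_map_eq {τ : 𝟭 D ⟶ 𝟭 D} (hτ : ∀ Y, τ.app Y = 0 ↔ F.essImage Y)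
    {K L : CochainComplex C ℤ} [K.IsStrictlyGE (-1)] [K.IsStrictlyLE 0] [L.IsStrictlyGE (-1)]
    [L.IsStrictlyLE 0] (h : ∀ g : K.homology 0 ⟶ L.homology (-1), g = 0)
    (φ : DerivedCategory.Q.obj (mapC F K) ⟶ DerivedCategory.Q.obj (mapC F L)) :
    ∃ (M : CochainComplex C ℤ) (s : M ⟶ K) (f : M ⟶ L) (_ : QuasiIso s),
      DerivedCategory.Q.map ((F.mapHomologicalComplex _).map s) ≫ φ =
        DerivedCategory.Q.map ((F.mapHomologicalComplex _).map f) := by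
  obtain ⟨A, _, _, s, hs, f, rfl⟩ :=
    DerivedCategory.right_fac_of_isStrictlyLE_of_isStrictlyGE (-1) 0 φ
  have hs' : QuasiIso s := by rwa [DerivedCategory.isIso_Q_map_iff_quasiIso] at hs
  let s₁ : A.X (-1) ⟶ F.obj (K.X (-1)) := s.f (-1)
  let f₁ : A.X (-1) ⟶ F.obj (L.X (-1)) := f.f (-1)
  obtain ⟨b, p, hp, hpK, hpL⟩ :
      ∃ (b : Butterfly (F.map (K.d (-1) 0)) (F.map (L.d (-1) 0))) (p : A.X 0 ⟶ b.E),
        A.d (-1) 0 ≫ p = s₁ ≫ b.lam + f₁ ≫ b.kap ∧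
        p ≫ b.epsK = s.f 0 ∧ p ≫ b.epsL = f.f 0 := exists_butterfly s f
  obtain ⟨E, ⟨e⟩⟩ := essImage_butterfly F hτ (eq_zero_of_homology h) b
  obtain ⟨b₀, e, h1, h2, h3, h4⟩ := b.exists_descend F e
  let u₁ : A.X (-1) ⟶ F.obj (b₀.complex.X (-1)) :=
    (s₁ ≫ F.map biprod.inl + f₁ ≫ F.map biprod.inr) ≫ F.map b₀.i₀.inv
  let u₀ : A.X 0 ⟶ F.obj (b₀.complex.X 0) := p ≫ e.inv ≫ F.map b₀.i₁.inv
  have hu : u₁ ≫ F.map (b₀.complex.d (-1) 0) = A.d (-1) 0 ≫ u₀ := by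
    simp only [u₁, u₀, Category.assoc, Preadditive.add_comp, ← Functor.map_comp, b₀.complex_d,
      Iso.inv_hom_id_assoc, biprod.inl_desc_assoc, biprod.inr_desc_assoc, reassoc_of% hp]
    simp only [Functor.map_comp, h1, h2, Category.assoc]
  -- The given roof factors through the image of the butterfly's roof via `u`. Both left legs are
  -- quasi-isomorphisms, hence so is `u`, and the two roofs define the same morphism.
  let u : A ⟶ mapC F b₀.complex := homOfTwoTerm _ _ u₁ u₀ hu
  have hu₁ : u.f (-1) = u₁ := homOfTwoTerm_f_neg_one _ _ _ _ _
  have hu₀ : u.f 0 = u₀ := homOfTwoTerm_f_zero _ _ _ _ _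
  have u1 : u ≫ (F.mapHomologicalComplex _).map b₀.toK = s := by
    refine twoTerm_hom_ext ?_ ?_
    · rw [HomologicalComplex.comp_f, hu₁]
      change u₁ ≫ F.map (b₀.toK.f (-1)) = s₁
      simp [Butterfly.toK, u₁, ← Functor.map_comp]
    · rw [HomologicalComplex.comp_f, hu₀]
      change u₀ ≫ F.map (b₀.toK.f 0) = _
      rw [Butterfly.toK, homOfTwoTerm_f_zero]
      simp [u₀, h3, hpK]
      rfl
  have u2 : u ≫ (F.mapHomologicalComplex _).map b₀.toL = f := by
    refine twoTerm_hom_ext ?_ ?_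
    · rw [HomologicalComplex.comp_f, hu₁]
      change u₁ ≫ F.map (b₀.toL.f (-1)) = f₁
      simp [Butterfly.toL, u₁, ← Functor.map_comp]
    · rw [HomologicalComplex.comp_f, hu₀]
      change u₀ ≫ F.map (b₀.toL.f 0) = _
      rw [Butterfly.toL, homOfTwoTerm_f_zero]
      simp [u₀, h4, hpL]
      rfl
  have hq : QuasiIso ((F.mapHomologicalComplex (ComplexShape.up ℤ)).map b₀.toK) := inferInstance
  have hq' : QuasiIso (u ≫ (F.mapHomologicalComplex (ComplexShape.up ℤ)).map b₀.toK) := by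
    rwa [u1]
  have hu2 : QuasiIso u := quasiIso_of_comp_right u
    ((F.mapHomologicalComplex (ComplexShape.up ℤ)).map b₀.toK)
  have hu' : IsIso (DerivedCategory.Q.map u) := by
    rwa [DerivedCategory.isIso_Q_map_iff_quasiIso]
  refine ⟨b₀.complex, b₀.toK, b₀.toL, inferInstance, ?_⟩
  rw [← cancel_epi (DerivedCategory.Q.map u), ← Functor.map_comp_assoc, u1,
    IsIso.hom_inv_id_assoc, ← Functor.map_comp, u2]

/-- Injectivity lifts a null-homotopy along `F`; surjectivity is `exists_map_eq`, transported along
the isomorphism between the derived functor and the termwise one. -/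
theorem bijective_mapDerivedCategory_of_twoTerm {τ : 𝟭 D ⟶ 𝟭 D}
    (hτ : ∀ Y, τ.app Y = 0 ↔ F.essImage Y)
    {K L : CochainComplex C ℤ} [K.IsStrictlyGE (-1)] [K.IsStrictlyLE 0] [L.IsStrictlyGE (-1)]
    [L.IsStrictlyLE 0] (h : ∀ g : K.homology 0 ⟶ L.homology (-1), g = 0) :
    Function.Bijective (F.mapDerivedCategory.map :
      (DerivedCategory.Q.obj K ⟶ DerivedCategory.Q.obj L) → _) := by
  let i := F.mapDerivedCategoryFactors
  have nat {M N : CochainComplex C ℤ} (f : M ⟶ N) :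
      F.mapDerivedCategory.map (DerivedCategory.Q.map f) = i.hom.app M ≫
        DerivedCategory.Q.map ((F.mapHomologicalComplex (ComplexShape.up ℤ)).map f) ≫
        i.inv.app N := by
    have := F.mapDerivedCategoryFactors_hom_naturality f
    rw [← reassoc_of% this]
    exact ((congrArg _ (Iso.hom_inv_id_app i N)).trans (Category.comp_id _)).symm
  constructor
  · rw [← Functor.coe_mapAddHom, injective_iff_map_eq_zero]
    intro g hg
    obtain ⟨A, _, _, s, hs, f, rfl⟩ :=
      DerivedCategory.right_fac_of_isStrictlyLE_of_isStrictlyGE (-1) 0 g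
    have hf : F.mapDerivedCategory.map (DerivedCategory.Q.map f) = 0 := by
      have := congrArg (F.mapDerivedCategory.map (DerivedCategory.Q.map s) ≫ ·) hg
      simpa using this
    have hf' : DerivedCategory.Q.map
        ((F.mapHomologicalComplex (ComplexShape.up ℤ)).map f) = 0 := by
      have := F.mapDerivedCategoryFactors_hom_naturality f
      rw [hf, zero_comp] at this
      rw [← cancel_epi (i.hom.app A), ← this, comp_zero]
    obtain ⟨θ, h1, h0⟩ := exists_homotopy_of_Q_map_eq_zero (K := mapC F A) (L := mapC F L) _ hf'
    -- Fullness lifts the homotopy, and faithfulness lifts its two defining equations.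
    obtain ⟨θ₀, hθ : F.map θ₀ = θ⟩ := F.map_surjective θ
    rw [Q_map_eq_zero_of_homotopy f θ₀ (F.map_injective ?_) (F.map_injective ?_), comp_zero]
    · rw [Functor.map_comp, hθ]; exact h1
    · rw [Functor.map_comp, hθ]; exact h0
  · intro φ
    obtain ⟨M, s, f, hs, e⟩ := exists_map_eq F hτ h (i.inv.app K ≫ φ ≫ i.hom.app L)
    have hs' : IsIso (DerivedCategory.Q.map s) := by
      rwa [DerivedCategory.isIso_Q_map_iff_quasiIso]
    refine ⟨inv (DerivedCategory.Q.map s) ≫ DerivedCategory.Q.map f, ?_⟩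
    rw [← cancel_epi (F.mapDerivedCategory.map (DerivedCategory.Q.map s)), ← Functor.map_comp,
      IsIso.hom_inv_id_assoc, nat, ← e, nat]
    have := Iso.hom_inv_id_app i L
    have h2 := Iso.inv_hom_id_app i K
    simp only [Category.assoc]
    rw [this]
    simp

/-- Objects with cohomology only in degrees −1, 0 have two-term representatives by truncation, and
both the Hom groups and the vanishing hypothesis are invariant under isomorphism. -/
theorem bijective_mapDerivedCategory {τ : 𝟭 D ⟶ 𝟭 D} (hτ : ∀ Y, τ.app Y = 0 ↔ F.essImage Y)
    (A B : DerivedCategory C)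
    (hA : ∀ i : ℤ, i ≠ 0 → i ≠ -1 → IsZero ((DerivedCategory.homologyFunctor C i).obj A))
    (hB : ∀ i : ℤ, i ≠ 0 → i ≠ -1 → IsZero ((DerivedCategory.homologyFunctor C i).obj B))
    (h : ∀ g : (DerivedCategory.homologyFunctor C 0).obj A ⟶
      (DerivedCategory.homologyFunctor C (-1)).obj B, g = 0) :
    Function.Bijective (F.mapDerivedCategory.map : (A ⟶ B) → _) := by
  have rep (A : DerivedCategory C)
      (hA : ∀ i : ℤ, i ≠ 0 → i ≠ -1 → IsZero ((DerivedCategory.homologyFunctor C i).obj A)) :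
      ∃ (K : CochainComplex C ℤ) (_ : K.IsStrictlyGE (-1)) (_ : K.IsStrictlyLE 0),
        Nonempty (A ≅ DerivedCategory.Q.obj K) := by
    have : A.IsGE (-1) := by
      rw [DerivedCategory.isGE_iff]
      exact fun i hi ↦ hA i (by lia) (by lia)
    have : A.IsLE 0 := by
      rw [DerivedCategory.isLE_iff]
      exact fun i hi ↦ hA i (by lia) (by lia)
    exact A.exists_iso_Q_obj_of_isGE_of_isLE (-1) 0
  obtain ⟨K, _, _, ⟨eA⟩⟩ := rep A hA
  obtain ⟨L, _, _, ⟨eB⟩⟩ := rep B hB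
  have h' : ∀ g : K.homology 0 ⟶ L.homology (-1), g = 0 := by
    intro g
    let iA : (DerivedCategory.homologyFunctor C 0).obj A ≅ K.homology 0 :=
      (DerivedCategory.homologyFunctor C 0).mapIso eA ≪≫
        (DerivedCategory.homologyFunctorFactors C 0).app K
    let iB : (DerivedCategory.homologyFunctor C (-1)).obj B ≅ L.homology (-1) :=
      (DerivedCategory.homologyFunctor C (-1)).mapIso eB ≪≫
        (DerivedCategory.homologyFunctorFactors C (-1)).app L
    have := h (iA.hom ≫ g ≫ iB.inv)
    simpa using this
  have hb := bijective_mapDerivedCategory_of_twoTerm F hτ h'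
  have e : (F.mapDerivedCategory.map : (A ⟶ B) → _) =
      ((F.mapDerivedCategory.mapIso eA).homCongr (F.mapDerivedCategory.mapIso eB)).symm ∘
        F.mapDerivedCategory.map ∘ (eA.homCongr eB) := by
    funext f
    simp
  rw [e]
  exact (Equiv.bijective _).comp (hb.comp (Equiv.bijective _))

omit [F.Full] [F.Faithful] in
/-- An exact functor commutes with the cohomology of objects of the derived category. -/
theorem nonempty_homologyFunctor_mapDerivedCategory_iso (A : DerivedCategory C) (i : ℤ) :
    Nonempty ((DerivedCategory.homologyFunctor D i).obj (F.mapDerivedCategory.obj A) ≅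
      F.obj ((DerivedCategory.homologyFunctor C i).obj A)) := by
  obtain ⟨K, ⟨e⟩⟩ : ∃ K : CochainComplex C ℤ, Nonempty (DerivedCategory.Q.obj K ≅ A) :=
    ⟨DerivedCategory.Q.objPreimage A, ⟨DerivedCategory.Q.objObjPreimageIso A⟩⟩
  let e₁ : F.mapDerivedCategory.obj A ≅ DerivedCategory.Q.obj (mapC F K) :=
    F.mapDerivedCategory.mapIso e.symm ≪≫ F.mapDerivedCategoryFactors.app K
  let e₂ : HomologicalComplex.homology (mapC F K) i ≅ F.obj (K.homology i) :=
    (K.sc i).mapHomologyIso F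
  exact ⟨(DerivedCategory.homologyFunctor D i).mapIso e₁ ≪≫
    (DerivedCategory.homologyFunctorFactors D i).app _ ≪≫ e₂ ≪≫
    F.mapIso (((DerivedCategory.homologyFunctorFactors C i).app K).symm ≪≫
      (DerivedCategory.homologyFunctor C i).mapIso e)⟩

end functor

/-! ### Sections, gluing, and multiplication by a global function -/

section restriction
variable {X : Scheme.{u}}

/-- Restriction of sections of a sheaf of modules. -/
noncomputable def res (M : X.Modules) {V W : X.Opens} (h : W ≤ V) : Γ(M, V) →+ Γ(M, W) :=
  (M.presheaf.map (homOfLE h).op).hom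

/-- Restriction of functions. -/
noncomputable def resO (X : Scheme.{u}) {V W : X.Opens} (h : W ≤ V) : Γ(X, V) →+* Γ(X, W) :=
  (X.presheaf.map (homOfLE h).op).hom

theorem res_res (M : X.Modules) {U V W : X.Opens} (h : V ≤ U) (h' : W ≤ V) (x : Γ(M, U)) :
    res M h' (res M h x) = res M (h'.trans h) x := by
  change M.presheaf.map (homOfLE h').op (M.presheaf.map (homOfLE h).op x) = _
  rw [← ConcreteCategory.comp_apply, ← Functor.map_comp]
  rfl

theorem resO_resO {U V W : X.Opens} (h : V ≤ U) (h' : W ≤ V) (x : Γ(X, U)) :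
    resO X h' (resO X h x) = resO X (h'.trans h) x := map_map_LE h h' x

theorem res_self (M : X.Modules) {U : X.Opens} (h : U ≤ U) (x : Γ(M, U)) : res M h x = x := by
  change M.presheaf.map (𝟙 (op U)) x = x
  rw [CategoryTheory.Functor.map_id]
  rfl

theorem resO_self {U : X.Opens} (h : U ≤ U) (x : Γ(X, U)) : resO X h x = x := by
  change X.presheaf.map (𝟙 (op U)) x = x
  rw [CategoryTheory.Functor.map_id]
  rfl

theorem res_smul (M : X.Modules) {V W : X.Opens} (h : W ≤ V) (r : Γ(X, V)) (x : Γ(M, V)) :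
    res M h (r • x) = resO X h r • res M h x := map_smul_LE M h r x

theorem app_res {M N : X.Modules} (f : M ⟶ N) {V W : X.Opens} (h : W ≤ V) (x : Γ(M, V)) :
    f.app W (res M h x) = res N h (f.app V x) := app_map f h x

theorem app_resO {Y : Scheme.{u}} (f : X ⟶ Y) {V W : Y.Opens} (h : W ≤ V) (r : Γ(Y, V)) :
    f.app W (resO Y h r) = resO X (Scheme.Hom.preimage_mono f h) (f.app V r) :=
  congr($(f.naturality (homOfLE h).op) r)

/-- Sections agreeing locally are equal. -/
theorem res_ext (M : X.Modules) {ι : Type*} {U : X.Opens} (V : ι → X.Opens) (hV : ∀ i, V i ≤ U)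
    (hc : U ≤ ⨆ i, V i) (x y : Γ(M, U)) (h : ∀ i, res M (hV i) x = res M (hV i) y) : x = y :=
  TopCat.Sheaf.eq_of_locally_eq' ⟨M.presheaf, M.isSheaf⟩ V U (fun i ↦ homOfLE (hV i)) hc x y h

theorem le_iSup_affine (U : X.Opens) : U ≤ ⨆ V : {V : X.affineOpens // V.1 ≤ U}, V.1.1 := by
  intro p hp
  obtain ⟨_, ⟨W, hW, rfl⟩, hpW, hWU⟩ :=
    X.isBasis_affineOpens.exists_subset_of_mem_open hp U.isOpen
  exact Opens.mem_iSup.mpr ⟨⟨⟨W, hW⟩, hWU⟩, hpW⟩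

theorem res_ext_affine (M : X.Modules) {U : X.Opens} (x y : Γ(M, U))
    (h : ∀ (V : X.Opens) (_ : IsAffineOpen V) (hV : V ≤ U), res M hV x = res M hV y) : x = y :=
  res_ext M (fun V : {V : X.affineOpens // V.1 ≤ U} ↦ V.1.1) (fun V ↦ V.2) (le_iSup_affine U) x y
    fun V ↦ h V.1.1 V.1.2 V.2

theorem exists_glue (M : X.Modules) {ι : Type u} {U : X.Opens} (V : ι → X.Opens)
    (hV : ∀ i, V i ≤ U) (hc : U ≤ ⨆ i, V i) (x : ∀ i, Γ(M, V i))
    (h : ∀ i j, res M (inf_le_left : V i ⊓ V j ≤ V i) (x i) =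
      res M (inf_le_right : V i ⊓ V j ≤ V j) (x j)) :
    ∃ y : Γ(M, U), ∀ i, res M (hV i) y = x i :=
  (TopCat.Sheaf.existsUnique_gluing' ⟨M.presheaf, M.isSheaf⟩ V U (fun i ↦ homOfLE (hV i)) hc x
    h).exists

/-- A morphism of sheaves of modules from compatible linear maps on sections. -/
noncomputable def mkHom {M N : X.Modules} (f : ∀ U : X.Opens, Γ(M, U) →+ Γ(N, U))
    (nat : ∀ {V W : X.Opens} (h : W ≤ V) (x : Γ(M, V)), f W (res M h x) = res N h (f V x))
    (lin : ∀ (U : X.Opens) (r : Γ(X, U)) (x : Γ(M, U)), f U (r • x) = r • f U x) : M ⟶ N :=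
  SheafOfModules.Hom.mk (PresheafOfModules.homMk
    { app := fun U ↦ AddCommGrpCat.ofHom (f U.unop)
      naturality := fun U V i ↦ by
        ext x
        exact nat i.unop.le x } fun U r x ↦ lin U.unop r x)

theorem modules_hom_ext {M N : X.Modules} {f g : M ⟶ N}
    (h : ∀ (U : X.Opens) (x : Γ(M, U)), f.app U x = g.app U x) : f = g := by
  refine Scheme.Modules.hom_ext f g fun U ↦ ?_
  ext x
  exact h U x

theorem isIso_of_app_bijective {M N : X.Modules} (f : M ⟶ N)
    (h : ∀ U : X.Opens, Function.Bijective (f.app U)) : IsIso f := by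
  rw [Scheme.Modules.Hom.isIso_iff_isIso_app]
  intro U
  rw [ConcreteCategory.isIso_iff_bijective]
  exact h U

/-- Multiplication by a global function, as an endomorphism of the identity of `Coh(X)`. -/
noncomputable def mulCoh (a : Γ(X, ⊤)) : 𝟭 (Coh X) ⟶ 𝟭 (Coh X) where
  app M := ObjectProperty.homMk (mkHom (M := M.obj) (N := M.obj)
    (fun U ↦ DistribSMul.toAddMonoidHom _ (resO X le_top a))
    (fun h x ↦ by
      simp only [DistribSMul.toAddMonoidHom_apply]
      rw [res_smul, resO_resO])
    (fun U r x ↦ by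
      simp only [DistribSMul.toAddMonoidHom_apply]
      rw [smul_comm]))
  naturality M N f := by
    ext1
    refine modules_hom_ext fun U x ↦ ?_
    exact (app_smul f.hom (resO X le_top a) x).symm

theorem mulCoh_app_eq_zero_iff (a : Γ(X, ⊤)) (M : Coh X) : (mulCoh a).app M = 0 ↔
    ∀ (U : X.Opens) (x : Γ(M.obj, U)), resO X (le_top : U ≤ ⊤) a • x = 0 := by
  constructor
  · intro h U x
    exact congr($(congrArg (fun f : M ⟶ M ↦ f.hom.app U) h) x)
  · intro h
    ext1
    exact modules_hom_ext h

end restriction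

/-! ### Pushforward along a closed immersion is fully faithful -/

section closedImmersion
variable {Z Y : Scheme.{u}} (j : Z ⟶ Y) [IsClosedImmersion j]

/-- The largest open subset of `Y` with preimage `V` under a closed immersion. -/
noncomputable def ext (V : Z.Opens) : Y.Opens :=
  ⟨(j '' (V : Set Z)ᶜ)ᶜ, (j.isClosedEmbedding.isClosedMap _ V.2.isClosed_compl).isOpen_compl⟩

theorem mem_ext {V : Z.Opens} {y : Y} : y ∈ ext j V ↔ ∀ z, j z = y → z ∈ V := by
  change y ∉ j '' (V : Set Z)ᶜ ↔ _
  simp only [Set.mem_image, not_exists, not_and', Set.mem_compl_iff, not_not]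
  rfl

theorem ext_mono {V W : Z.Opens} (h : V ≤ W) : ext j V ≤ ext j W := fun _ hy ↦
  (mem_ext j).mpr fun z hz ↦ h ((mem_ext j).mp hy z hz)

theorem preimage_ext (V : Z.Opens) : j ⁻¹ᵁ ext j V = V := by
  refine Opens.ext (Set.ext fun z ↦ ?_)
  change j z ∈ ext j V ↔ z ∈ V
  rw [mem_ext]
  refine ⟨fun h ↦ h z rfl, fun h z' hz ↦ ?_⟩
  rwa [j.isClosedEmbedding.injective hz]

theorem le_ext (U : Y.Opens) : U ≤ ext j (j ⁻¹ᵁ U) := fun _ hy ↦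
  (mem_ext j).mpr fun z hz ↦ by
    change j z ∈ U
    rwa [hz]

theorem le_ext_of_preimage_le {U : Y.Opens} {V : Z.Opens} (h : j ⁻¹ᵁ U ≤ V) : U ≤ ext j V :=
  (le_ext j U).trans (ext_mono j h)

theorem preimage_le_of_le_ext {U : Y.Opens} {V : Z.Opens} (h : U ≤ ext j V) : j ⁻¹ᵁ U ≤ V :=
  (Scheme.Hom.preimage_mono j h).trans (preimage_ext j V).le

/-- `ext j ⊥` is the complement of the image of `Z`, and a point of the image lies in `ext j (j ⁻¹ᵁ
U)` only if it lies in `U`. -/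
theorem ext_preimage_le (U : Y.Opens) : ext j (j ⁻¹ᵁ U) ≤ U ⊔ ext j ⊥ := by
  intro y hy
  by_cases h : y ∈ ext j ⊥
  · exact Or.inr h
  · left
    rw [mem_ext] at hy h
    push Not at h
    obtain ⟨z, rfl, -⟩ := h
    exact hy z rfl

section preimage
variable {M N : Z.Modules}
  (g : (Scheme.Modules.pushforward j).obj M ⟶ (Scheme.Modules.pushforward j).obj N)

/-- Sections of the morphism inducing a given morphism of pushforwards. -/
noncomputable def preimageApp (V : Z.Opens) : Γ(M, V) →+ Γ(N, V) :=
  (res N (preimage_ext j V).ge).comp ((g.app (ext j V)).hom.comp (res M (preimage_ext j V).le))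

/-- The value on `V` can be computed on any open of `Y` with preimage inside `V`. -/
theorem res_preimageApp {V : Z.Opens} {U : Y.Opens} (h : j ⁻¹ᵁ U ≤ V) (x : Γ(M, V)) :
    res N h (preimageApp j g V x) = g.app U (res M h x) := by
  have h' : U ≤ ext j V := le_ext_of_preimage_le j h
  have e : g.app U (res M (Scheme.Hom.preimage_mono j h') (res M (preimage_ext j V).le x)) =
      res N (Scheme.Hom.preimage_mono j h') (g.app (ext j V) (res M (preimage_ext j V).le x)) :=
    app_res g h' _
  have e1 : res M (Scheme.Hom.preimage_mono j h') (res M (preimage_ext j V).le x) = res M h x :=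
    res_res _ _ _ _
  have e2 : res N h (preimageApp j g V x) = res N (Scheme.Hom.preimage_mono j h')
      (g.app (ext j V) (res M (preimage_ext j V).le x)) := res_res _ _ _ _
  rw [e2, ← e]
  exact congrArg (g.app U) e1

/-- The topology of `Z` is induced from `Y`, so preimages of affine opens of `Y` cover `V`.
Affineness in `Y` is wanted because functions on `Z` lift over such opens. -/
theorem sections_ext_preimage (N : Z.Modules) {V : Z.Opens} (x y : Γ(N, V))
    (h : ∀ (U : Y.Opens) (_ : IsAffineOpen U) (hU : j ⁻¹ᵁ U ≤ V), res N hU x = res N hU y) :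
    x = y := by
  refine res_ext N (fun U : {U : Y.affineOpens // U.1 ≤ ext j V} ↦ j ⁻¹ᵁ U.1.1)
    (fun U ↦ preimage_le_of_le_ext j U.2) ?_ x y
    fun U ↦ h U.1.1 U.1.2 (preimage_le_of_le_ext j U.2)
  intro z hz
  have hz' : j z ∈ ext j V := by
    have := (preimage_ext j V).ge hz
    exact this
  obtain ⟨U, hU⟩ := Opens.mem_iSup.mp (le_iSup_affine (ext j V) hz')
  exact Opens.mem_iSup.mpr ⟨U, hU⟩

/-- The morphism inducing a given morphism of pushforwards along a closed immersion. -/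
noncomputable def pushforwardPreimage : M ⟶ N :=
  mkHom (preimageApp j g)
    (fun {V W} h x ↦ by
      refine sections_ext_preimage j N _ _ fun U _ hU ↦ ?_
      rw [res_preimageApp, res_res, res_res, res_preimageApp])
    (fun V r x ↦ by
      refine sections_ext_preimage j N _ _ fun U hU hUV ↦ ?_
      -- Linearity over `Z` reduces to linearity over `Y` once the function is lifted.
      obtain ⟨r', hr'⟩ := j.app_surjective U hU (resO Z hUV r)
      rw [res_smul, res_preimageApp, res_preimageApp, res_smul, ← hr']
      exact app_smul g r' _)

theorem pushforward_map_preimage :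
    (Scheme.Modules.pushforward j).map (pushforwardPreimage j g) = g := by
  refine modules_hom_ext fun U x ↦ ?_
  have := res_preimageApp j g (le_refl (j ⁻¹ᵁ U)) x
  exact ((res_self N _ _).symm.trans this).trans (congrArg (g.app U) (res_self M _ x))

end preimage

instance : (Scheme.Modules.pushforward j).Full where
  map_surjective g := ⟨pushforwardPreimage j g, pushforward_map_preimage j g⟩

instance : (Scheme.Modules.pushforward j).Faithful where
  map_injective {M N} f g h := by
    refine modules_hom_ext fun V x ↦ sections_ext_preimage j N _ _ fun U _ hU ↦ ?_
    rw [← app_res, ← app_res]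
    exact congr($(congrArg (fun k ↦ Scheme.Modules.Hom.app k U) h) _)

instance : (pushforwardCoh j).Full where
  map_surjective {M N} g := by
    obtain ⟨f, hf⟩ := (Scheme.Modules.pushforward j).map_surjective g.hom
    refine ⟨ObjectProperty.homMk f, ?_⟩
    ext1
    exact hf

instance : (pushforwardCoh j).Faithful where
  map_injective {M N} f g h := by
    ext1
    exact (Scheme.Modules.pushforward j).map_injective ((isCoherent Y).ι.congr_map h)

end closedImmersion

/-! ### Descending a module killed by the ideal of a closed subscheme -/

section descent
variable {Z Y : Scheme.{u}} (j : Z ⟶ Y)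

/-- The sheaf of modules `E` is killed by the ideal of `Z`. -/
def IsKilled (E : Y.Modules) : Prop :=
  ∀ (U : Y.Opens) (_ : IsAffineOpen U) (r : Γ(Y, U)), j.app U r = 0 → ∀ x : Γ(E, U), r • x = 0

variable {j} {E : Y.Modules} (hE : IsKilled j E)
include hE

theorem IsKilled.smul_eq {U : Y.Opens} (hU : IsAffineOpen U) {r r' : Γ(Y, U)}
    (h : j.app U r = j.app U r') (x : Γ(E, U)) : r • x = r' • x := by
  rw [← sub_eq_zero, ← sub_smul]
  exact hE U hU _ (by rw [map_sub, h, sub_self]) x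

variable [IsClosedImmersion j]

/-- Sections of `E` vanish away from `Z`. -/
theorem IsKilled.eq_zero {U : Y.Opens} (hU : U ≤ ext j ⊥) (x : Γ(E, U)) : x = 0 := by
  refine res_ext_affine E _ _ fun V hV hVU ↦ ?_
  have hs : Subsingleton Γ(Z, j ⁻¹ᵁ V) := by
    have : j ⁻¹ᵁ V = ⊥ := le_bot_iff.mp (preimage_le_of_le_ext j (hVU.trans hU))
    rw [this]
    infer_instance
  -- The preimage of `V` in `Z` is empty, so the function 1 restricts to zero there and must kill
  -- the sections of `E`.
  have := hE V hV 1 (Subsingleton.elim _ _) (res E hVU x)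
  rw [one_smul] at this
  rw [this, map_zero]

variable (j E) in
omit hE [IsClosedImmersion j] in
/-- `y` is the product of `x` with the function `r` on `Z`. -/
def IsAct {U : Y.Opens} (r : Γ(Z, j ⁻¹ᵁ U)) (x y : Γ(E, U)) : Prop :=
  ∀ (W : Y.Opens) (_ : IsAffineOpen W) (hW : W ≤ U) (r' : Γ(Y, W)),
    j.app W r' = resO Z (Scheme.Hom.preimage_mono j hW) r → res E hW y = r' • res E hW x

/-- A function on `Z` lifts to `Y` only over affine opens. Two lifts differ by an element of the
ideal, which kills `E`, so the local products do not depend on the lifts and glue uniquely. -/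
theorem IsKilled.existsUnique_isAct {U : Y.Opens} (r : Γ(Z, j ⁻¹ᵁ U)) (x : Γ(E, U)) :
    ∃! y, IsAct j E r x y := by
  have lift (W : {V : Y.affineOpens // V.1 ≤ U}) :=
    j.app_surjective W.1.1 W.1.2 (resO Z (Scheme.Hom.preimage_mono j W.2) r)
  choose l hl using lift
  obtain ⟨y, hy⟩ := exists_glue E (fun V : {V : Y.affineOpens // V.1 ≤ U} ↦ V.1.1) (fun V ↦ V.2)
    (le_iSup_affine U) (fun W ↦ l W • res E W.2 x) (by
      intro W W'
      refine res_ext_affine E _ _ fun V hV hVW ↦ ?_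
      rw [res_res, res_res, res_smul, res_smul, res_res, res_res]
      refine hE.smul_eq hV ?_ _
      rw [app_resO, app_resO, hl, hl, resO_resO, resO_resO])
  have hy' : IsAct j E r x y := fun W hW hWU r' hr' ↦ by
    have h1 := hy ⟨⟨W, hW⟩, hWU⟩
    have h2 := hl ⟨⟨W, hW⟩, hWU⟩
    dsimp only at h1 h2
    rw [h1]
    exact hE.smul_eq hW (h2.trans hr'.symm) _
  refine ⟨y, hy', fun y' h ↦ res_ext_affine E _ _ fun W hW hWU ↦ ?_⟩
  obtain ⟨r', hr'⟩ := j.app_surjective W hW (resO Z (Scheme.Hom.preimage_mono j hWU) r)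
  rw [h W hW hWU r' hr', hy' W hW hWU r' hr']

/-- The action of functions on `Z` on the sections of a module killed by the ideal of `Z`. -/
noncomputable def IsKilled.act {U : Y.Opens} (r : Γ(Z, j ⁻¹ᵁ U)) (x : Γ(E, U)) : Γ(E, U) :=
  (hE.existsUnique_isAct r x).choose

theorem IsKilled.isAct_act {U : Y.Opens} (r : Γ(Z, j ⁻¹ᵁ U)) (x : Γ(E, U)) :
    IsAct j E r x (hE.act r x) :=
  (hE.existsUnique_isAct r x).choose_spec.1

theorem IsKilled.act_eq {U : Y.Opens} {r : Γ(Z, j ⁻¹ᵁ U)} {x y : Γ(E, U)} (h : IsAct j E r x y) :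
    hE.act r x = y :=
  ((hE.existsUnique_isAct r x).choose_spec.2 y h).symm

theorem IsKilled.act_app {U : Y.Opens} (r : Γ(Y, U)) (x : Γ(E, U)) :
    hE.act (j.app U r) x = r • x :=
  hE.act_eq fun W hW hWU r' hr' ↦ by
    rw [res_smul]
    exact hE.smul_eq hW (by rw [hr', app_resO]) _

theorem IsKilled.res_act {U V : Y.Opens} (h : V ≤ U) (r : Γ(Z, j ⁻¹ᵁ U)) (x : Γ(E, U)) :
    res E h (hE.act r x) = hE.act (resO Z (Scheme.Hom.preimage_mono j h) r) (res E h x) :=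
  (hE.act_eq fun W hW hWV r' hr' ↦ by
    rw [res_res, hE.isAct_act r x W hW (hWV.trans h) r' (by rw [hr', resO_resO]), res_res]).symm

/-- The module structure on `Γ(E, U)` over the ring of functions on the preimage of `U` in `Z`. -/
@[reducible]
noncomputable def IsKilled.module (U : Y.Opens) : Module Γ(Z, j ⁻¹ᵁ U) Γ(E, U) where
  smul := hE.act
  one_smul x := hE.act_eq fun W hW hWU r' hr' ↦ by
    rw [map_one, ← map_one (j.app W).hom] at hr'
    exact ((hE.smul_eq hW hr' _).trans (one_smul _ _)).symm
  mul_smul r r₂ x := hE.act_eq fun W hW hWU r' hr' ↦ by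
    obtain ⟨a, ha⟩ := j.app_surjective W hW (resO Z (Scheme.Hom.preimage_mono j hWU) r)
    obtain ⟨b, hb⟩ := j.app_surjective W hW (resO Z (Scheme.Hom.preimage_mono j hWU) r₂)
    rw [map_mul, ← ha, ← hb, ← map_mul] at hr'
    refine (hE.isAct_act r _ W hW hWU a ha).trans ?_
    rw [hE.smul_eq hW hr', mul_smul]
    exact congrArg (a • ·) (hE.isAct_act r₂ _ W hW hWU b hb)
  smul_zero r := hE.act_eq fun W hW hWU r' hr' ↦ by rw [map_zero, smul_zero]
  smul_add r x y := hE.act_eq fun W hW hWU r' hr' ↦ by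
    rw [map_add, map_add, smul_add]
    exact congrArg₂ (· + ·) (hE.isAct_act r x W hW hWU r' hr') (hE.isAct_act r y W hW hWU r' hr')
  add_smul r r₂ x := hE.act_eq fun W hW hWU r' hr' ↦ by
    obtain ⟨a, ha⟩ := j.app_surjective W hW (resO Z (Scheme.Hom.preimage_mono j hWU) r)
    obtain ⟨b, hb⟩ := j.app_surjective W hW (resO Z (Scheme.Hom.preimage_mono j hWU) r₂)
    rw [map_add, ← ha, ← hb, ← map_add] at hr'
    rw [hE.smul_eq hW hr', add_smul, map_add]
    exact congrArg₂ (· + ·) (hE.isAct_act r x W hW hWU a ha) (hE.isAct_act r₂ x W hW hWU b hb)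
  zero_smul x := hE.act_eq fun W hW hWU r' hr' ↦ by
    rw [map_zero] at hr'
    rw [map_zero, hE W hW r' hr']

omit hE
variable (j E) in
/-- The presheaf `V ↦ Γ(E, ext V)` on `Z`. -/
noncomputable def extPresheaf : TopCat.Presheaf Ab.{u} Z :=
  (Monotone.functor (f := ext j) fun _ _ h ↦ ext_mono j h).op ⋙ E.presheaf

include hE

/-- Gluing on `Z` is reduced to gluing on `Y` along the opens `ext j (V i)`, with the complement of
`Z` added as the index `none`; the addition matters for the empty family. Since `E` has only the
zero section over opens inside that complement, the extra member changes neither the gluing data nor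
uniqueness. -/
theorem IsKilled.isSheaf_extPresheaf : (extPresheaf j E).IsSheaf := by
  rw [TopCat.Presheaf.isSheaf_iff_isSheafUniqueGluing]
  intro ι V x hx
  have hc : ext j (⨆ i, V i) ≤ ⨆ o : Option ι, o.elim (ext j ⊥) (fun i ↦ ext j (V i)) := by
    intro y hy
    by_cases h : y ∈ ext j ⊥
    · exact Opens.mem_iSup.mpr ⟨none, h⟩
    · rw [mem_ext] at hy h
      push Not at h
      obtain ⟨z, rfl, -⟩ := h
      obtain ⟨i, hi⟩ := Opens.mem_iSup.mp (hy z rfl)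
      exact Opens.mem_iSup.mpr ⟨some i, (preimage_ext j (V i)).ge hi⟩
  have hle (o : Option ι) : o.elim (ext j ⊥) (fun i ↦ ext j (V i)) ≤ ext j (⨆ i, V i) := by
    cases o with
    | none => exact ext_mono j bot_le
    | some i => exact ext_mono j (le_iSup V i)
  have hle' (i : ι) : ext j (V i) ≤ ext j (⨆ i, V i) := hle (some i)
  have hinf (i i' : ι) : ext j (V i) ⊓ ext j (V i') ≤ ext j (V i ⊓ V i') :=
    le_ext_of_preimage_le j (le_inf (preimage_le_of_le_ext j inf_le_left)
      (preimage_le_of_le_ext j inf_le_right))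
  let x' (o : Option ι) : Γ(E, o.elim (ext j ⊥) (fun i ↦ ext j (V i))) :=
    match o with
    | none => 0
    | some i => x i
  obtain ⟨y, hy⟩ := exists_glue E _ hle hc x' (by
    rintro (_ | i) (_ | i')
    · rfl
    · exact (hE.eq_zero inf_le_left _).trans (hE.eq_zero inf_le_left _).symm
    · exact (hE.eq_zero inf_le_right _).trans (hE.eq_zero inf_le_right _).symm
    · have h1 : res E (ext_mono j inf_le_left) (x i) = res E (ext_mono j inf_le_right) (x i') :=
        hx i i'
      have h2 := congrArg (res E (hinf i i')) h1
      exact (res_res E _ _ (show Γ(E, ext j (V i)) from x i)).symm.trans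
        (h2.trans (res_res E _ _ (show Γ(E, ext j (V i')) from x i'))))
  refine ⟨y, fun i ↦ hy (some i), fun y' h ↦ ?_⟩
  refine res_ext E _ hle hc _ _ fun o ↦ ?_
  cases o with
  | none => exact (hE.eq_zero le_rfl _).trans (hE.eq_zero le_rfl _).symm
  | some i => exact (h i).trans (hy (some i)).symm

/-- The action of functions on `V ⊆ Z` on `Γ(E, ext V)`. -/
@[reducible]
noncomputable def IsKilled.extModule (V : Z.Opens) : Module Γ(Z, V) Γ(E, ext j V) :=
  letI := hE.module (ext j V)
  Module.compHom _ (resO Z (preimage_ext j V).le)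

/-- The sheaf of modules on `Z` defined by a sheaf of modules on `Y` killed by the ideal of `Z`. -/
noncomputable def IsKilled.descend : Z.Modules :=
  letI : ∀ V : (Opens Z)ᵒᵖ, Module (Z.ringCatSheaf.obj.obj V) ((extPresheaf j E).obj V) :=
    fun V ↦ hE.extModule V.unop
  { val := PresheafOfModules.ofPresheaf (extPresheaf j E) (fun V W f r x ↦ by
      have h := hE.res_act (ext_mono j f.unop.le) (resO Z (preimage_ext j V.unop).le r) x
      exact h.trans (congrArg (hE.act · _) ((resO_resO (preimage_ext j V.unop).le _ r).trans
        (resO_resO f.unop.le (preimage_ext j W.unop).le r).symm)))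
    isSheaf := hE.isSheaf_extPresheaf }

/-- The comparison morphism between the pushforward of the descended module and the original. -/
noncomputable def IsKilled.descendHom : (Scheme.Modules.pushforward j).obj hE.descend ⟶ E :=
  mkHom (M := (Scheme.Modules.pushforward j).obj hE.descend) (N := E)
    (fun U ↦ res E (le_ext j U))
    (fun {V W} h x ↦ (res_res E _ _ _).trans (res_res E _ _ _).symm)
    (fun U r x ↦ by
      have e : resO Z (Scheme.Hom.preimage_mono j (le_ext j U))
          (resO Z (preimage_ext j (j ⁻¹ᵁ U)).le (j.app U r)) = j.app U r :=
        (resO_resO _ _ _).trans (resO_self _ _)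
      exact (hE.res_act (le_ext j U) _ _).trans
        ((congrArg (hE.act · _) e).trans (hE.act_app r _)))

/-- On sections over `U` the morphism is the restriction from `ext j (j ⁻¹ᵁ U)` to `U`. These opens
differ only off `Z`, where `E` is zero, so a section over `U` extends uniquely by zero. -/
theorem IsKilled.isIso_descendHom : IsIso hE.descendHom := by
  refine isIso_of_app_bijective _ fun U ↦ ?_
  let V (b : Bool) : Y.Opens := if b then U else ext j ⊥
  have hV (b : Bool) : V b ≤ ext j (j ⁻¹ᵁ U) := by
    cases b
    · exact ext_mono j bot_le
    · exact le_ext j U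
  have hc : ext j (j ⁻¹ᵁ U) ≤ ⨆ b, V b := (ext_preimage_le j U).trans
    (sup_le (le_iSup V true) (le_iSup V false))
  change Function.Bijective (res E (le_ext j U))
  constructor
  · intro x y h
    refine res_ext E V hV hc x y fun b ↦ ?_
    cases b
    · exact (hE.eq_zero le_rfl _).trans (hE.eq_zero le_rfl _).symm
    · exact h
  · intro x
    let V' (b : ULift.{u} Bool) : Y.Opens := V b.down
    obtain ⟨y, hy⟩ := exists_glue E V' (fun b ↦ hV b.down)
      (hc.trans (iSup_le fun b ↦ le_iSup V' ⟨b⟩))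
      (fun b ↦ match b with
        | ⟨true⟩ => x
        | ⟨false⟩ => 0) (by
        rintro ⟨_ | _⟩ ⟨_ | _⟩
        · rfl
        · exact (hE.eq_zero inf_le_left _).trans (hE.eq_zero inf_le_left _).symm
        · exact (hE.eq_zero inf_le_right _).trans (hE.eq_zero inf_le_right _).symm
        · rfl)
    exact ⟨y, hy ⟨true⟩⟩

end descent

/-! ### Finiteness of sections is local -/

section finiteness
variable {X : Scheme.{u}} (M : X.Modules)

theorem isLocalizedModule_of_locAt {U : X.Opens} (g : Γ(X, U))
    (h : LocAt M g le_rfl (X.basicOpen_le g)) :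
    letI := Module.compHom Γ(M, X.basicOpen g) (resO X (X.basicOpen_le g))
    ∃ f : Γ(M, U) →ₗ[Γ(X, U)] Γ(M, X.basicOpen g), IsLocalizedModule.Away g f := by
  let := Module.compHom Γ(M, X.basicOpen g) (resO X (X.basicOpen_le g))
  have hsmul (r : Γ(X, U)) (x : Γ(M, X.basicOpen g)) :
      r • x = resO X (X.basicOpen_le g) r • x := rfl
  let f : Γ(M, U) →ₗ[Γ(X, U)] Γ(M, X.basicOpen g) :=
    { toFun := res M (X.basicOpen_le g)
      map_add' := map_add _
      map_smul' := fun r x ↦ res_smul M _ r x }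
  refine ⟨f, IsLocalizedModule.Away.mk_of_addCommGroup ?_ (fun s ↦ ?_) (fun t ht ↦ ?_)⟩
  · have hu : IsUnit (resO X (X.basicOpen_le g) g) := X.toRingedSpace.isUnit_res_basicOpen g
    rw [Module.End.isUnit_iff]
    have : ⇑(algebraMap Γ(X, U) (Module.End Γ(X, U) Γ(M, X.basicOpen g)) g) =
        fun x ↦ resO X (X.basicOpen_le g) g • x := rfl
    rw [this]
    obtain ⟨v, hv⟩ := hu
    rw [← hv]
    exact MulAction.bijective v
  · obtain ⟨n, t, ht⟩ := h.1 s
    refine ⟨n, t, ?_⟩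
    rw [hsmul, map_pow]
    exact ht.symm
  · obtain ⟨n, hn⟩ := h.2 t ht
    refine ⟨n, ?_⟩
    have e : X.presheaf.map (homOfLE (le_refl U)).op g = g := resO_self le_rfl g
    rwa [e] at hn

/-- Finiteness of sections over affine opens can be checked on an affine cover. -/
theorem finite_of_affine_cover (hM : M.IsQuasicoherent) {ι : Type*} (V : ι → X.affineOpens)
    (hV : (⨆ i, (V i : X.Opens)) = ⊤) (h : ∀ i, Module.Finite Γ(X, (V i).1) Γ(M, (V i).1))
    (U : X.Opens) (hU : IsAffineOpen U) : Module.Finite Γ(X, U) Γ(M, U) := by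
  rw [isQuasicoherent_iff] at hM
  refine of_affine_open_cover (P := fun U : X.affineOpens ↦ Module.Finite Γ(X, U.1) Γ(M, U.1))
    V hV ⟨U, hU⟩ ?_ ?_ h
  · intro U g hf
    change Module.Finite Γ(X, X.basicOpen g) Γ(M, X.basicOpen g)
    let := Module.compHom Γ(M, X.basicOpen g) (resO X (X.basicOpen_le g))
    obtain ⟨f, hf'⟩ := isLocalizedModule_of_locAt M g (hM U.1 U.2 g)
    let : Algebra Γ(X, U.1) Γ(X, X.basicOpen g) := (resO X (X.basicOpen_le g)).toAlgebra
    have : IsLocalization.Away g Γ(X, X.basicOpen g) := U.2.isLocalization_basicOpen g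
    have : IsScalarTower Γ(X, U.1) Γ(X, X.basicOpen g) Γ(M, X.basicOpen g) :=
      .of_algebraMap_smul fun _ _ ↦ rfl
    exact Module.Finite.of_isLocalizedModule (.powers g) (Rₚ := Γ(X, X.basicOpen g)) f
  · intro U s hs hf
    let (g : s) := Module.compHom Γ(M, X.basicOpen g.1) (resO X (X.basicOpen_le g.1))
    have hloc (g : s) := isLocalizedModule_of_locAt M g.1 (hM U.1 U.2 g.1)
    choose f hf' using hloc
    let (g : s) : Algebra Γ(X, U.1) Γ(X, X.basicOpen g.1) :=
      (resO X (X.basicOpen_le g.1)).toAlgebra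
    have (g : s) : IsLocalization.Away g.1 Γ(X, X.basicOpen g.1) :=
      U.2.isLocalization_basicOpen g.1
    have (g : s) : IsScalarTower Γ(X, U.1) Γ(X, X.basicOpen g.1) Γ(M, X.basicOpen g.1) :=
      .of_algebraMap_smul fun _ _ ↦ rfl
    exact Module.Finite.of_localizationSpan_finite' s hs
      (Rₚ := fun g ↦ Γ(X, X.basicOpen g.1)) f hf

end finiteness

/-! ### The essential image of pushforward along a closed immersion with one equation -/

section essImage
variable {Z Y : Scheme.{u}} (j : Z ⟶ Y) [IsClosedImmersion j]

/-- Preimages of affine opens of `Y` form an affine cover of `Z`. Over these, functions on `Z` lift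
to `Y` and act through the lifts, so localisation and finiteness carry over from the pushforward;
both are then local on `Z`. -/
theorem isCoherent_of_pushforward (M : Z.Modules)
    (hM : isCoherent Y ((Scheme.Modules.pushforward j).obj M)) : isCoherent Z M := by
  have hloc (U : Y.Opens) (hU : IsAffineOpen U) (g : Γ(Z, j ⁻¹ᵁ U)) :
      LocAt M g le_rfl (Z.basicOpen_le g) := by
    obtain ⟨g, rfl⟩ := j.app_surjective U hU g
    have h := (isQuasicoherent_iff _).mp hM.1 U hU g
    have key : ∀ (W : Z.Opens) (hW : W ≤ j ⁻¹ᵁ U) (_ : W = Z.basicOpen (j.app U g)),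
        LocAt M (j.app U g) le_rfl hW → LocAt M (j.app U g) le_rfl (Z.basicOpen_le (j.app U g)) := by
      rintro W hW rfl h; exact h
    refine key (j ⁻¹ᵁ Y.basicOpen g) (Scheme.Hom.preimage_mono j (Y.basicOpen_le g))
      (Scheme.preimage_basicOpen _ _) ?_
    have hg (V : Y.Opens) (hV : V ≤ U) : j.app V (Y.presheaf.map (homOfLE hV).op g) =
        Z.presheaf.map (homOfLE (Scheme.Hom.preimage_mono j hV)).op (j.app U g) :=
      congr($(j.naturality (homOfLE hV).op) g)
    have hpow (V : Y.Opens) (hV : V ≤ U) (n : ℕ) :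
        j.app V (Y.presheaf.map (homOfLE hV).op g ^ n) =
          Z.presheaf.map (homOfLE (Scheme.Hom.preimage_mono j hV)).op (j.app U g) ^ n := by
      rw [map_pow, hg]
    refine ⟨fun s ↦ ?_, fun t ht ↦ ?_⟩
    · obtain ⟨n, t, ht⟩ := h.1 s
      refine ⟨n, t, ?_⟩
      exact ht.trans (congrArg (· • (show Γ(M, j ⁻¹ᵁ Y.basicOpen g) from s))
        (hpow (Y.basicOpen g) (Y.basicOpen_le g) n))
    · obtain ⟨n, hn⟩ := h.2 t ht
      refine ⟨n, ?_⟩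
      exact (congrArg (· • (show Γ(M, j ⁻¹ᵁ U) from t)) (hpow U le_rfl n)).symm.trans hn
  let V (U : Y.affineOpens) : Z.affineOpens := ⟨j ⁻¹ᵁ U.1, U.2.preimage j⟩
  have hV : (⨆ U, (V U : Z.Opens)) = ⊤ := by
    have := congrArg (fun W ↦ j ⁻¹ᵁ W) (iSup_affineOpens_eq_top Y)
    refine eq_top_iff.mpr fun z _ ↦ ?_
    have hz : j z ∈ (⨆ U : Y.affineOpens, (U : Y.Opens)) := by
      rw [iSup_affineOpens_eq_top]; trivial
    obtain ⟨U, hU⟩ := Opens.mem_iSup.mp hz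
    exact Opens.mem_iSup.mpr ⟨U, hU⟩
  have hq : M.IsQuasicoherent := by
    have (U : Y.affineOpens) : (M.over (V U).1).IsQuasicoherent := by
      refine isQuasicoherent_restrict M (V U).2 ?_
      rw [isQuasicoherent_iff_isIso_fromTildeΓ, isIso_fromTildeΓ_iff_isLocalizing]
      exact (isLocalizing_iff M (V U).2).mpr (hloc U.1 U.2)
    refine SheafOfModules.IsQuasicoherent.of_coversTop M (fun U ↦ (V U).1) ?_
    rw [Opens.coversTop_iff]
    exact hV
  refine ⟨hq, fun U hU ↦ finite_of_affine_cover M hq V hV (fun W ↦ ?_) U hU⟩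
  have h := hM.2 W.1 W.2
  have hfin := h.1
  obtain ⟨s, hs⟩ := hfin
  -- The same finite set generates: functions on `Y` act through their images on `Z`, so every
  -- combination over `Y` is a combination over `Z`.
  refine ⟨s, eq_top_iff.mpr fun x _ ↦ ?_⟩
  have hx : x ∈ (⊤ : Submodule Γ(Y, W.1) Γ((Scheme.Modules.pushforward j).obj M, W.1)) := trivial
  rw [← hs] at hx
  induction hx using Submodule.span_induction with
  | mem x hx => exact Submodule.subset_span hx
  | zero => exact Submodule.zero_mem _
  | add x y _ _ hx hy => exact Submodule.add_mem _ (hx trivial) (hy trivial)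
  | smul r x _ hx => exact Submodule.smul_mem _ (j.app W.1 r) (hx trivial)

/-- The closed immersion `j` is cut out by the global function `a`. -/
structure IsCutOutBy (a : Γ(Y, ⊤)) : Prop where
  app_eq_zero : j.app ⊤ a = 0
  exists_eq_mul : ∀ (U : Y.Opens) (_ : IsAffineOpen U) (r : Γ(Y, U)), j.app U r = 0 →
    ∃ c : Γ(Y, U), r = c * resO Y (le_top : U ≤ ⊤) a

variable {j} {a : Γ(Y, ⊤)} (ha : IsCutOutBy j a)
include ha

omit [IsClosedImmersion j] in
theorem IsCutOutBy.isKilled {E : Coh Y} (h : (mulCoh a).app E = 0) : IsKilled j E.obj := by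
  rw [mulCoh_app_eq_zero_iff] at h
  intro U hU r hr x
  obtain ⟨c, rfl⟩ := ha.exists_eq_mul U hU r hr
  rw [mul_smul, h, smul_zero]

/-- The essential image of the pushforward consists of the sheaves killed by the equation. -/
theorem IsCutOutBy.mulCoh_app_eq_zero_iff (E : Coh Y) :
    (mulCoh a).app E = 0 ↔ (pushforwardCoh j).essImage E := by
  constructor
  · intro h
    have hE := ha.isKilled h
    have := hE.isIso_descendHom
    let e : (Scheme.Modules.pushforward j).obj hE.descend ≅ E.obj := asIso hE.descendHom
    have hc : isCoherent Y ((Scheme.Modules.pushforward j).obj hE.descend) :=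
      (isCoherent Y).prop_of_iso e.symm E.property
    refine ⟨⟨hE.descend, isCoherent_of_pushforward j _ hc⟩, ⟨?_⟩⟩
    exact (isCoherent Y).isoMk e
  · rintro ⟨M, ⟨e⟩⟩
    have h : (mulCoh a).app ((pushforwardCoh j).obj M) = 0 := by
      rw [PTCoh.mulCoh_app_eq_zero_iff]
      intro U x
      have : j.app U (resO Y le_top a) = 0 := by
        rw [app_resO, ha.app_eq_zero, map_zero]
      change (show Γ(M.obj, j ⁻¹ᵁ U) from j.app U (resO Y le_top a) •
        (show Γ(M.obj, j ⁻¹ᵁ U) from x)) = 0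
      rw [this, zero_smul]
    have n := (mulCoh a).naturality e.hom
    rw [h, zero_comp] at n
    exact zero_of_epi_comp e.hom n

end essImage

/-! ### Supports under quotients -/

section support
variable {X : Scheme.{u}}

/-- A stalk is zero exactly when all its germs are. Phrased through sections, this compares supports
without computing stalks of quotients or pushforwards. -/
theorem notMem_supp_iff (M : X.Modules) (x : X) : x ∉ supp M ↔
    ∀ (U : X.Opens) (_ : x ∈ U) (s : Γ(M, U)),
      ∃ (W : X.Opens) (h : W ≤ U), x ∈ W ∧ res M h s = 0 := by
  change ¬ Nontrivial (TopCat.Presheaf.stalk M.presheaf x : Ab.{u}) ↔ _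
  rw [not_nontrivial_iff_subsingleton]
  constructor
  · intro h U hx s
    obtain ⟨W, hW, i, i', e⟩ := M.presheaf.germ_eq x hx hx s 0 (Subsingleton.elim _ _)
    refine ⟨W, i.le, hW, ?_⟩
    exact e.trans (map_zero (M.presheaf.map i'.op).hom)
  · intro h
    refine ⟨fun a b ↦ ?_⟩
    have key (t : (TopCat.Presheaf.stalk M.presheaf x : Ab.{u})) : t = 0 := by
      obtain ⟨U, hU, s, rfl⟩ := M.presheaf.exists_germ_eq t
      obtain ⟨W, hWU, hW, e⟩ := h U hU s
      have e' : M.presheaf.map (homOfLE hWU).op s = 0 := e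
      rw [← TopCat.Presheaf.germ_res_apply M.presheaf (homOfLE hWU) x hW s, e', map_zero]
    rw [key a, key b]

/-- Over an affine neighbourhood a section of the quotient lifts to `M`, and it vanishes wherever
its lift does. -/
theorem supp_subset_of_epi {M N : Coh X} [IsLocallyNoetherian X] (f : M ⟶ N) [Epi f] :
    supp N.obj ⊆ supp M.obj := by
  have := (isCoherent X).preservesEpimorphisms_ι_of_isNormalMonoCategory
  have : Epi ((isCoherent X).ι.map f) := inferInstance
  intro x
  contrapose
  rw [notMem_supp_iff, notMem_supp_iff]
  intro h U hx s
  obtain ⟨_, ⟨V, hV, rfl⟩, hxV, hVU⟩ := X.isBasis_affineOpens.exists_subset_of_mem_open hx U.isOpen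
  obtain ⟨t, ht⟩ :=
    app_surjective ((isCoherent X).ι.map f) M.property.1 N.property.1 V hV (res N.obj hVU s)
  obtain ⟨W, hWV, hxW, e⟩ := h V hxV t
  refine ⟨W, hWV.trans hVU, hxW, ?_⟩
  rw [← res_res N.obj hVU hWV, ← ht]
  refine (app_res ((isCoherent X).ι.map f) hWV t).symm.trans ?_
  erw [e]
  exact map_zero _

theorem cohLE_of_epi {M N : Coh X} [IsLocallyNoetherian X] (f : M ⟶ N) [Epi f] {d : ℕ}
    (h : cohLE X d M) : cohLE X d N :=
  (Topology.IsInducing.topologicalKrullDim_le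
    (Topology.IsEmbedding.inclusion (supp_subset_of_epi f)).isInducing).trans h

theorem cohGE_of_iso {M N : Coh X} (e : M ≅ N) {d : ℕ} (h : cohGE X d M) : cohGE X d N :=
  fun F hF φ ↦ (cancel_mono e.inv).mp (by rw [h F hF (φ ≫ e.inv), zero_comp])

end support

/-! ### Pushforward preserves hearts and their Hom groups -/

section pushforward
variable {Z Y : Scheme.{u}} (j : Z ⟶ Y) [IsClosedImmersion j]

/-- At a point of `Z`, neighbourhoods in `Z` and in `Y` correspond through `ext` and preimage. At a
point off `Z`, there is a neighbourhood with empty preimage. -/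
theorem supp_pushforward (M : Z.Modules) :
    supp ((Scheme.Modules.pushforward j).obj M) = j '' supp M := by
  refine Set.ext fun y ↦ not_iff_not.mp ?_
  rw [notMem_supp_iff]
  constructor
  · rintro h ⟨z, hz, rfl⟩
    refine (notMem_supp_iff M z).mpr (fun V hV s ↦ ?_) hz
    have hV' : j z ∈ ext j V := (preimage_ext j V).ge hV
    obtain ⟨W, hW, hzW, e⟩ := h (ext j V) hV' (res M (preimage_ext j V).le s)
    refine ⟨j ⁻¹ᵁ W, preimage_le_of_le_ext j hW, hzW, ?_⟩
    exact (res_res M (preimage_ext j V).le (Scheme.Hom.preimage_mono j hW) s).symm.trans e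
  · intro h U hy s
    by_cases hy' : y ∈ ext j ⊥
    · refine ⟨U ⊓ ext j ⊥, inf_le_left, ⟨hy, hy'⟩, ?_⟩
      have hb : j ⁻¹ᵁ (U ⊓ ext j ⊥) ≤ ⊥ := preimage_le_of_le_ext j inf_le_right
      -- The empty family covers an empty open set, so its sections are all equal.
      exact res_ext M (fun i : Empty ↦ i.elim) (fun i ↦ i.elim) (hb.trans bot_le) _ _ fun i ↦ i.elim
    · rw [mem_ext] at hy'
      push Not at hy'
      obtain ⟨z, rfl, -⟩ := hy'
      have hz : z ∉ supp M := fun hz ↦ h ⟨z, hz, rfl⟩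
      obtain ⟨W, hW, hzW, e⟩ := (notMem_supp_iff M z).mp hz (j ⁻¹ᵁ U) hy s
      have hW' : j ⁻¹ᵁ (U ⊓ ext j W) ≤ W := preimage_le_of_le_ext j inf_le_right
      refine ⟨U ⊓ ext j W, inf_le_left, ⟨hy, (preimage_ext j W).ge hzW⟩, ?_⟩
      refine (res_res M hW hW' s).symm.trans ?_
      rw [e, map_zero]
      rfl

theorem cohLE_pushforward_iff (M : Coh Z) (d : ℕ) :
    cohLE Y d ((pushforwardCoh j).obj M) ↔ cohLE Z d M := by
  have e := j.isClosedEmbedding.isEmbedding.homeomorphImage (supp M.obj)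
  have h : topologicalKrullDim (supp M.obj) =
      topologicalKrullDim (supp ((pushforwardCoh j).obj M).obj) := by
    change _ = topologicalKrullDim (supp ((Scheme.Modules.pushforward j).obj M.obj))
    rw [supp_pushforward]
    exact IsHomeomorph.topologicalKrullDim_eq _ e.isHomeomorph
  unfold cohLE
  rw [h]

variable {j} [IsLocallyNoetherian Y] {a : Γ(Y, ⊤)}

/-- The source `F` of a test map need not come from `Z`, but the image of the map does: as a
subobject of `j_* E` it is killed by `a`. As a quotient of `F` it also has small support, so by
fullness its inclusion comes from a map on `Z` that must vanish. -/
theorem IsCutOutBy.cohGE_pushforward (ha : IsCutOutBy j a) {E : Coh Z} {d : ℕ}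
    (hE : cohGE Z d E) : cohGE Y d ((pushforwardCoh j).obj E) := by
  intro F hF φ
  have hE0 : (mulCoh a).app ((pushforwardCoh j).obj E) = 0 :=
    (ha.mulCoh_app_eq_zero_iff _).mpr ((pushforwardCoh j).obj_mem_essImage E)
  have hI : (mulCoh a).app (Abelian.image φ) = 0 := by
    have n := (mulCoh a).naturality (Abelian.image.ι φ)
    rw [hE0, comp_zero] at n
    exact zero_of_comp_mono (Abelian.image.ι φ) n.symm
  obtain ⟨I, ⟨e⟩⟩ := (ha.mulCoh_app_eq_zero_iff _).mp hI
  have hI' : cohLE Z d I := (cohLE_pushforward_iff j I d).mp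
    (cohLE_of_epi (Abelian.factorThruImage φ ≫ e.inv) hF)
  obtain ⟨ψ, hψ⟩ := (pushforwardCoh j).map_surjective (e.hom ≫ Abelian.image.ι φ)
  rw [hE I hI' ψ, Functor.map_zero] at hψ
  have h0 : Abelian.image.ι φ = 0 := zero_of_epi_comp e.hom hψ.symm
  rw [← Abelian.image.fac φ, h0, comp_zero]

variable [IsLocallyNoetherian Z]

/-- Exactness makes pushforward commute with cohomology sheaves, so the three conditions can be
checked one sheaf at a time. -/
theorem IsCutOutBy.heart_pushforward (ha : IsCutOutBy j a) {E : DCoh Z} (hE : heart Z E) :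
    heart Y ((pushforwardD j).obj E) := by
  obtain ⟨h0, h1, h⟩ := hE
  have iso := nonempty_homologyFunctor_mapDerivedCategory_iso (pushforwardCoh j) E
  refine ⟨?_, ?_, fun i hi hi' ↦ ?_⟩
  · exact cohLE_of_epi (iso 0).some.inv ((cohLE_pushforward_iff j _ 1).mpr h0)
  · exact cohGE_of_iso (iso (-1)).some.symm (ha.cohGE_pushforward h1)
  · exact ((pushforwardCoh j).map_isZero (h i hi hi')).of_iso (iso i).some

theorem IsCutOutBy.bijective_pushforwardD (ha : IsCutOutBy j a) {A B : DCoh Z}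
    (hA : heart Z A) (hB : heart Z B) : Function.Bijective
      fun f : A ⟶ B ↦ (pushforwardD j).map f :=
  bijective_mapDerivedCategory (pushforwardCoh j) ha.mulCoh_app_eq_zero_iff A B hA.2.2 hB.2.2
    (hB.2.1 _ hA.1)

end pushforward

/-! ### Base change of a principal closed immersion is cut out by one function -/

/-- Since the kernel of `g` lies in `(a)`, the map from `A` to `C/(f a)` factors through `B`. The
universal property then gives a map `D ⟶ C/(f a)` under `C`, so whatever dies in `D` is a multiple
of `f a`. -/
theorem _root_.CommRingCat.exists_eq_mul_of_isPushout {A B C D : CommRingCat.{u}} {f : A ⟶ C}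
    {g : A ⟶ B} {i : C ⟶ D} {l : B ⟶ D} (h : IsPushout f g i l) (hg : Function.Surjective g)
    {a : A} (hk : ∀ x, g x = 0 → x ∈ Ideal.span {a}) {r : C} (hr : i r = 0) :
    ∃ c : C, r = c * f a := by
  let q := Ideal.Quotient.mk (Ideal.span {f a})
  have hq : RingHom.ker g.hom ≤ RingHom.ker (q.comp f.hom) := fun x hx ↦ by
    obtain ⟨y, rfl⟩ := Ideal.mem_span_singleton'.mp (hk x hx)
    rw [RingHom.mem_ker, RingHom.comp_apply, map_mul, map_mul]
    have : q (f.hom a) = 0 := Ideal.Quotient.eq_zero_iff_mem.mpr (Ideal.mem_span_singleton_self _)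
    rw [this, mul_zero]
  let t : B ⟶ CommRingCat.of (C ⧸ Ideal.span {f a}) :=
    CommRingCat.ofHom (g.hom.liftOfSurjective hg ⟨q.comp f.hom, hq⟩)
  have w : f ≫ CommRingCat.ofHom q = g ≫ t := by
    ext x
    exact (RingHom.liftOfRightInverse_comp_apply g.hom _ (Function.rightInverse_surjInv hg)
      ⟨q.comp f.hom, hq⟩ x).symm
  have e : q r = h.desc (CommRingCat.ofHom q) t w (i r) :=
    congr($(h.inl_desc (CommRingCat.ofHom q) t w) r).symm
  rw [hr, map_zero] at e
  obtain ⟨c, hc⟩ := Ideal.mem_span_singleton'.mp (Ideal.Quotient.eq_zero_iff_mem.mp e)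
  exact ⟨c, hc.symm⟩

/-- Restricting the square to an affine open of `Y` gives a pullback of affine schemes, hence a
pushout of rings, and the preceding lemma bounds the kernel there. -/
theorem isCutOutBy_of_isPullback {Z Y S T : Scheme.{u}} [IsAffine S] [IsAffine T] {j : Z ⟶ Y}
    {p : Z ⟶ T} {q : Y ⟶ S} {i : T ⟶ S} (sq : IsPullback j p q i)
    (hi : Function.Surjective i.appTop) (a : Γ(S, ⊤)) (ha : i.appTop a = 0)
    (hk : ∀ x, i.appTop x = 0 → x ∈ Ideal.span {a}) : IsCutOutBy j (q.appTop a) where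
  app_eq_zero := by
    have h : q.appTop ≫ j.appTop = i.appTop ≫ p.appTop := by
      rw [← Scheme.Hom.comp_appTop, ← Scheme.Hom.comp_appTop, sq.w]
    have := congr($h a)
    rw [CommRingCat.comp_apply, CommRingCat.comp_apply, ha, map_zero] at this
    exact this
  exists_eq_mul U hU r hr := by
    have : IsAffine U := hU
    have h := isPushout_appTop_of_isPullback
      ((isPullback_morphismRestrict j U).paste_vert sq)
    have hW : U.ι ''ᵁ ⊤ ≤ U := U.ι_image_top.le
    have hW' : U ≤ U.ι ''ᵁ ⊤ := U.ι_image_top.ge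
    have hr' : (j ∣_ U).appTop (resO Y hW r) = 0 := by
      rw [morphismRestrict_appTop]
      have h0 : j.app (U.ι ''ᵁ ⊤) (resO Y hW r) = 0 := by rw [app_resO, hr, map_zero]
      let f := (Z.presheaf.map (eqToHom (image_morphismRestrict_preimage j U ⊤)).op).hom
      exact (congrArg f h0).trans (map_zero f)
    obtain ⟨c, hc⟩ := CommRingCat.exists_eq_mul_of_isPushout h hi hk hr'
    refine ⟨resO Y hW' c, ?_⟩
    have e : resO Y hW' (resO Y hW r) = resO Y hW' c * resO Y hW' ((U.ι ≫ q).appTop a) :=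
      (congrArg (resO Y hW') hc).trans (map_mul _ _ _)
    have e' : resO Y hW' ((U.ι ≫ q).appTop a) = resO Y le_top (q.appTop a) := by
      rw [Scheme.Hom.comp_appTop]
      exact resO_resO (le_top : U.ι ''ᵁ ⊤ ≤ ⊤) hW' (q.appTop a)
    rwa [resO_resO, resO_self, e'] at e

section baseChange
variable {k : Type u} [Field k] {X : Scheme.{u}} (s : X ⟶ Spec (.of k)) {A B : Type u}
  [CommRing A] [Algebra k A] [CommRing B] [Algebra k B] (φ : A →ₐ[k] B)

theorem isPullback_baseChangeMap : IsPullback (baseChangeMap s φ)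
    (pullback.snd s (Spec.map (CommRingCat.ofHom (algebraMap k B))))
    (pullback.snd s (Spec.map (CommRingCat.ofHom (algebraMap k A))))
    (Spec.map (CommRingCat.ofHom (φ : A →+* B))) := by
  have big : IsPullback (baseChangeMap s φ ≫ pullback.fst s _)
      (pullback.snd s (Spec.map (CommRingCat.ofHom (algebraMap k B)))) s
      (Spec.map (CommRingCat.ofHom (φ : A →+* B)) ≫
        Spec.map (CommRingCat.ofHom (algebraMap k A))) := by
    rw [specMap_comp]
    have e : baseChangeMap s φ ≫ pullback.fst s _ = pullback.fst s _ :=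
      (pullback.lift_fst _ _ _).trans (Category.comp_id _)
    rw [e]
    exact IsPullback.of_hasPullback s (Spec.map (CommRingCat.ofHom (algebraMap k B)))
  exact IsPullback.of_right big (pullback.lift_snd _ _ _)
    (IsPullback.of_hasPullback s (Spec.map (CommRingCat.ofHom (algebraMap k A))))

/-- If `A → B` is surjective with principal kernel, then `X ⊗ B ⟶ X ⊗ A` is cut out by one
global function. -/
theorem exists_isCutOutBy_baseChangeMap (hφ : Function.Surjective φ) (a : A)
    (ha : ∀ x, φ x = 0 ↔ x ∈ Ideal.span {a}) : ∃ b, IsCutOutBy (baseChangeMap s φ) b := by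
  let e (C : Type u) [CommRing C] := (Scheme.ΓSpecIso (.of C)).commRingCatIsoToRingEquiv
  let i := Spec.map (CommRingCat.ofHom (φ : A →+* B))
  have nat (x : A) : i.appTop ((e A).symm x) = (e B).symm (φ x) :=
    congr($(Scheme.ΓSpecIso_inv_naturality (CommRingCat.ofHom (φ : A →+* B))) x).symm
  refine ⟨_, isCutOutBy_of_isPullback (isPullback_baseChangeMap s φ) ?_ ((e A).symm a) ?_ ?_⟩
  · intro y
    obtain ⟨x, hx⟩ := hφ (e B y)
    exact ⟨(e A).symm x, (nat x).trans (by rw [hx, RingEquiv.symm_apply_apply])⟩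
  · refine (nat a).trans ?_
    rw [(ha a).mpr (Ideal.mem_span_singleton_self a), map_zero]
  · intro x hx
    obtain ⟨x, rfl⟩ := (e A).symm.surjective x
    have h : (e B).symm (φ x) = 0 := (nat x).symm.trans hx
    rw [map_eq_zero_iff _ (e B).symm.injective, ha] at h
    obtain ⟨c, rfl⟩ := Ideal.mem_span_singleton'.mp h
    exact Ideal.mem_span_singleton'.mpr ⟨(e A).symm c, (map_mul _ _ _).symm⟩

variable {R : Type u} [CommRing R] [Algebra k R] (π : R)

theorem exists_isCutOutBy_iota (m : ℕ) : ∃ b, IsCutOutBy (iota s π m) b :=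
  exists_isCutOutBy_baseChangeMap s _ (Ideal.Quotient.mkₐ_surjective _ _) (π ^ m) fun _ ↦
    Ideal.Quotient.eq_zero_iff_mem

theorem exists_isCutOutBy_iota' (m m' : ℕ) (h : m' ≤ m) : ∃ b, IsCutOutBy (iota' s π m m' h) b := by
  refine exists_isCutOutBy_baseChangeMap s _ (fun x ↦ ?_)
    (Ideal.Quotient.mk (Ideal.span {π ^ m}) (π ^ m')) fun x ↦ ?_
  · obtain ⟨y, rfl⟩ := Ideal.Quotient.mk_surjective x
    exact ⟨Ideal.Quotient.mk _ y, rfl⟩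
  · obtain ⟨y, rfl⟩ := Ideal.Quotient.mk_surjective x
    change Ideal.Quotient.mk (Ideal.span {π ^ m'}) y = 0 ↔ _
    rw [Ideal.Quotient.eq_zero_iff_mem, Ideal.mem_span_singleton', Ideal.mem_span_singleton']
    constructor
    · rintro ⟨c, rfl⟩
      exact ⟨Ideal.Quotient.mk _ c, (map_mul _ _ _).symm⟩
    · rintro ⟨c, hc⟩
      obtain ⟨c, rfl⟩ := Ideal.Quotient.mk_surjective c
      rw [← map_mul, Ideal.Quotient.eq, Ideal.mem_span_singleton'] at hc
      obtain ⟨d, hd⟩ := hc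
      -- The lift `c` is correct only modulo `π ^ m`; as `m' ≤ m`, the error `d * π ^ m` is itself a
      -- multiple of `π ^ m'` and is absorbed into the coefficient.
      refine ⟨c - d * π ^ (m - m'), ?_⟩
      rw [sub_mul, mul_assoc, ← pow_add, Nat.sub_add_cancel h, hd]
      ring

end baseChange

end PTCoh

theorem lemma5p6 {k : Type u} [Field k] [IsAlgClosed k] [CharZero k]
    {R : Type u} [CommRing R] [IsDomain R] [IsDiscreteValuationRing R] [Algebra k R]
    (π : R) (hπ : Irreducible π) {X : Scheme.{u}} (s : X ⟶ Spec (.of k))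
    [IsSmoothProjectiveThreefold s] :
    (∀ m : ℕ, 1 ≤ m → ∀ A B : (heart (thickening s π m)).FullSubcategory,
      Function.Bijective fun f : A ⟶ B ↦ (pushforwardD (iota s π m)).map f.hom) ∧
    (∀ (m m' : ℕ) (_ : 1 ≤ m') (h : m' < m),
      ∃ hA : ∀ A : (heart (thickening s π m')).FullSubcategory,
          heart (thickening s π m) ((pushforwardD (iota' s π m m' h.le)).obj A.obj),
        ∀ A B : (heart (thickening s π m')).FullSubcategory,
          Function.Bijective fun f : A ⟶ B ↦
            ((heart (thickening s π m)).lift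
              ((heart (thickening s π m')).ι ⋙ pushforwardD (iota' s π m m' h.le)) hA).map f) := by
  refine ⟨fun m _ A B ↦ ?_, fun m m' _ h ↦ ?_⟩
  · obtain ⟨b, hb⟩ := exists_isCutOutBy_iota s π m
    exact (hb.bijective_pushforwardD A.property B.property).comp
      InducedCategory.homEquiv.bijective
  · obtain ⟨b, hb⟩ := exists_isCutOutBy_iota' s π m m' h.le
    refine ⟨fun A ↦ hb.heart_pushforward A.property, fun A B ↦ ?_⟩
    exact InducedCategory.homEquiv.symm.bijective.comp
      ((hb.bijective_pushforwardD A.property B.property).comp InducedCategory.homEquiv.bijective)
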